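/- **Notation.** Let $n\ge 1$ and $A=[a_{ij}]\in M_n(\mathbb R)$. The triangularisation $\nabla(A)$ is the upper triangular matrix with entries $a_{ij}+a_{ji}$ for $i<j$ and $a_{ii}$ on the diagonal. $A$ is *unidiagonal* if all $a_{ii}=1$, and *triangle-integral* if $\nabla(A)$ has integer entries. A *loop-free bigraph* $\Delta$ on $\{1,\dots,n\}$ is a loop-free multigraph with solid and dotted edges in which two vertices are joined by edges of at most one kind; it is given by integers $d_{ab}=d_{ba}$ ($a\ne b$): there are $d_{ab}$ dotted edges between $a$ and $b$ if $d_{ab}>0$, and $-d_{ab}$ solid ones if $d_{ab}<0$. Its Gram matrix is the upper triangular matrix with unit diagonal and entries $d_{ab}$, $a<b$. For a unidiagonal triangle-integral matrix $A$ let $\Delta(A)$ be the bigraph with Gram matrix $\nabla(A)$; $A$ is *connected* if the underlying graph of $\Delta(A)$ is connected. The inflation $t_a\Delta$ at a vertex $a$ replaces $d_{ac}$ by $-d_{ac}$ for all $c\neq a$. If $d_{ab}>0$, the inflation $t_{a,b}\Delta$ at the pair $(a,b)$ replaces $d_{ab}$ by $-d_{ab}$ and $d_{bc}$ by $d_{bc}-d_{ac}d_{ab}$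 for all $c\ne a,b$. All other coefficients stay unchanged. A *Dynkin graph* is a bigraph without dotted or multiple edges that is isomorphic to one of $\mathbb A_n$ ($n\ge1$), $\mathbb D_n$ ($n\ge4$), $\mathbb E_6,\mathbb E_7,\mathbb E_8$. Put $\varphi(n)=\frac12(n^2-n)$ for $n\le 3$, $\varphi(6)=30$, $\varphi(7)=56$, $\varphi(8)=112$, and $\varphi(n)=n^2-2n$ otherwise; and $\psi(n)=0$ for $n\le 3$, $\psi(6)=5$, $\psi(7)=10$, $\psi(8)=21$, and $\psi(n)=n-3$ otherwise. **Algorithms.** The strategies $s=0,1,2,3$ for the selection of a dotted edge (given by a pair $a<b$ with $d_{ab}>0$) are: the first one in the lexicographic order; the last one; the first or the last one, at random; a random one. *Loop* $L(\Delta,s,r)$: while $\Delta$ has a dotted edge and fewer than $r$ inflations have been performed, select a dotted edge $(a,b)$ with respect to $s$ and set $\Delta:=t_{a,b}\Delta$. Return $\Delta$. *Root procedure* $R(\Delta)$: set $S:=\{1\}$; while $|S|<n$, choose $a\in S$, $b\notin S$ with $d_{ab}\neq0$; if $d_{ab}<0$, set $\Delta:=t_b\Delta$; then set $\Delta:=t_{b,a}\Delta$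 and $S:=S\cup\{b\}$. Return $\Delta$. PosDefTestByInflations$(A,s)$: compute $D:=L(\Delta(A),s,\varphi(n))$ and return true if and only if $D$ is a Dynkin graph. PosDefTestByRootInflations$(A,s)$: compute $D:=L(R(\Delta(A)),s,\psi(n))$ and return true if and only if $D$ is a Dynkin graph. **Theorem 3.** Let $A\in M_n(\mathbb R)$, $n\ge1$, be a connected unidiagonal triangle-integral matrix and $s\in\{0,1,2,3\}$ an arbitrary fixed strategy. Working on the upper triangular Gram matrix, and counting each arithmetic operation, comparison, memory access and elementary command as one operation: (a) the worst-case (pessimistic) complexity of PosDefTestByInflations, applied to $A$ and $s$, is $O(n^4)$; (b) the worst-case complexity of PosDefTestByRootInflations, applied to $A$ and $s$, is $O(n^3)$. That is, there is an absolute constant $C$ and there are implementations of the two algorithms as fixed programs (independent of $n$) of a random access machine with unit cost such that, for all $n$, $A$, $s$ and all outcomes of the random choices, the program halts after at most $Cn^4$ (respectively $Cn^3$) operations, having computed a bigraph $D$ and an answer as a run of the algorithm prescribes. -/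

import Mathlib

/-! ## Unidiagonal triangle-integral matrices and bigraphs -/

section Matrices

variable {n : ℕ}

/-- The upper triangularisation of a square matrix. -/
def triangularisation (A : Matrix (Fin n) (Fin n) ℝ) : Matrix (Fin n) (Fin n) ℝ :=
  fun i j => if i < j then A i j + A j i else if i = j then A i i else 0

def IsUnidiagonal (A : Matrix (Fin n) (Fin n) ℝ) : Prop := ∀ i, A i i = 1

def IsTriangleIntegral (A : Matrix (Fin n) (Fin n) ℝ) : Prop :=
  ∀ i j, ∃ z : ℤ, triangularisation A i j = z

end Matrices

/-- A loop-free edge-bipartite graph on the vertices `0, …, n - 1`.  Two distinct vertices are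
joined by edges of only one kind, so the edges between `a` and `b` are recorded by one integer
`d a b = d b a` (the off-diagonal coefficient of the Gram matrix): there are `d a b` dotted edges
if `d a b > 0`, and `-d a b` solid edges if `d a b < 0`. -/
@[ext]
structure Bigraph (n : ℕ) where
  d : Fin n → Fin n → ℤ
  symm : ∀ a b, d a b = d b a
  loopless : ∀ a, d a a = 0

namespace Bigraph

variable {n : ℕ}

/-- There is a dotted edge between `a` and `b`. -/
def Dotted (Δ : Bigraph n) (a b : Fin n) : Prop := 0 < Δ.d a b

/-- The underlying simple graph: `a` and `b` are adjacent when some edge joins them. -/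
def underlying (Δ : Bigraph n) : SimpleGraph (Fin n) where
  Adj a b := Δ.d a b ≠ 0
  symm := ⟨fun a b h => by rw [Δ.symm b a]; exact h⟩
  loopless := ⟨fun a h => h (Δ.loopless a)⟩

def Connected (Δ : Bigraph n) : Prop := Δ.underlying.Connected

/-- The bigraph of a unidiagonal triangle-integral matrix `A`: for `a < b` the number `d a b` is
the coefficient `A a b + A b a` of the triangularisation.  (That coefficient is an integer, so
the floor only changes its type.) -/
noncomputable def ofMatrix (A : Matrix (Fin n) (Fin n) ℝ) : Bigraph n where
  d a b := if a = b then 0 else ⌊A a b + A b a⌋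
  symm a b := by simp only [eq_comm (a := a), add_comm (A a b)]
  loopless a := by simp

/-- Inflation at a vertex: all edges at `a` change their kind. -/
def inflateVertex (a : Fin n) (Δ : Bigraph n) : Bigraph n where
  d i j := if i = a ∨ j = a then -Δ.d i j else Δ.d i j
  symm i j := by simp only [or_comm (a := i = a), Δ.symm i j]
  loopless i := by simp [Δ.loopless]

/-- Inflation at the pair `(a, b)`; it is used only if `a` and `b` are joined by dotted edges. -/
def inflatePair (a b : Fin n) (Δ : Bigraph n) : Bigraph n where
  d i j :=
    if i = j then 0
    else if (i = a ∧ j = b) ∨ (i = b ∧ j = a) then -Δ.d a b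
    else if i = b then Δ.d b j - Δ.d a j * Δ.d a b
    else if j = b then Δ.d b i - Δ.d a i * Δ.d a b
    else Δ.d i j
  symm i j := by
    have h := Δ.symm i j
    by_cases h0 : i = j <;> by_cases h1 : i = a <;> by_cases h2 : i = b <;>
      by_cases h3 : j = a <;> by_cases h4 : j = b <;> simp_all [eq_comm]
  loopless i := by simp

end Bigraph

/-- The graph on `0, …, n - 1` that consists of the path `0 — 1 — ⋯ — n - 2` and of one more
vertex `n - 1`, joined to the vertex `k` of the path. -/
def branchedPath (n k : ℕ) : SimpleGraph (Fin n) :=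
  SimpleGraph.fromRel fun i j : Fin n =>
    ((i : ℕ) + 1 = j ∧ (j : ℕ) + 1 < n) ∨ ((i : ℕ) = k ∧ (j : ℕ) + 1 = n)

namespace Bigraph

variable {n : ℕ}

/-- `Δ` has no dotted and no multiple edges, and it is isomorphic to one of the graphs `𝔸ₙ`
(`n ≥ 1`), `𝔻ₙ` (`n ≥ 4`), `𝔼₆`, `𝔼₇`, `𝔼₈`. -/
def IsDynkin (Δ : Bigraph n) : Prop :=
  (∀ a b, Δ.d a b = 0 ∨ Δ.d a b = -1) ∧
    ((1 ≤ n ∧ Nonempty (Δ.underlying ≃g SimpleGraph.pathGraph n)) ∨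
      (4 ≤ n ∧ Nonempty (Δ.underlying ≃g branchedPath n 1)) ∨
      (6 ≤ n ∧ n ≤ 8 ∧ Nonempty (Δ.underlying ≃g branchedPath n 2)))

/-! ## The algorithms on bigraphs

The algorithms make random (or unspecified) choices, so they are given by their possible runs. -/

/-- The pair `a < b` is joined by dotted edges and precedes all other such pairs in the
lexicographic order. -/
def IsFirstDotted (Δ : Bigraph n) (a b : Fin n) : Prop :=
  (a < b ∧ Δ.Dotted a b) ∧ ∀ a' b', a' < b' → Δ.Dotted a' b' → toLex (a, b) ≤ toLex (a', b')

/-- The same for the last pair. -/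
def IsLastDotted (Δ : Bigraph n) (a b : Fin n) : Prop :=
  (a < b ∧ Δ.Dotted a b) ∧ ∀ a' b', a' < b' → Δ.Dotted a' b' → toLex (a', b') ≤ toLex (a, b)

/-- The dotted edges between `a` and `b` can be selected with respect to the strategy:
first (0), last (1), first or last (2), any (3). -/
def Selects (Δ : Bigraph n) : Fin 4 → Fin n → Fin n → Prop
  | 0, a, b => Δ.IsFirstDotted a b
  | 1, a, b => Δ.IsLastDotted a b
  | 2, a, b => Δ.IsFirstDotted a b ∨ Δ.IsLastDotted a b
  | 3, a, b => a < b ∧ Δ.Dotted a b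

/-- `InflationsAtPair s r Δ D`: starting from `Δ`, the loop "while there is a dotted edge, select
one with respect to the strategy `s` and inflate at it", broken after `r` inflations, may end
with `D`. -/
inductive InflationsAtPair (s : Fin 4) : ℕ → Bigraph n → Bigraph n → Prop
  | done (r : ℕ) (Δ : Bigraph n) : (∀ a b, ¬ Δ.Dotted a b) → InflationsAtPair s r Δ Δ
  | broken (Δ : Bigraph n) : InflationsAtPair s 0 Δ Δ
  | step (r : ℕ) (Δ D : Bigraph n) (a b : Fin n) : Δ.Selects s a b →
      InflationsAtPair s r (Δ.inflatePair a b) D → InflationsAtPair s (r + 1) Δ D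

open Classical in
/-- `RootLoop S Δ Δ'`: the main loop of the procedure that makes a positive sincere root appear,
started with the vertex set `S` and with `Δ`, may end with `Δ'`. -/
inductive RootLoop : Finset (Fin n) → Bigraph n → Bigraph n → Prop
  | done (S : Finset (Fin n)) (Δ : Bigraph n) : S.card = n → RootLoop S Δ Δ
  | step (S : Finset (Fin n)) (Δ Δ' : Bigraph n) (a b : Fin n) : S.card < n →
      a ∈ S → b ∉ S → Δ.d a b ≠ 0 →
      RootLoop (insert b S)
        ((if Δ.Dotted a b then Δ else Δ.inflateVertex b).inflatePair b a) Δ' →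
      RootLoop S Δ Δ'

/-- The procedure `InflationsToPosSincereRoot`, started with `S = {first vertex}`. -/
def InflationsToPosSincereRoot [NeZero n] (Δ Δ' : Bigraph n) : Prop := RootLoop {0} Δ Δ'

end Bigraph

/-- The bound for the number of inflations at a pair for positive bigraphs. -/
def boundPos (n : ℕ) : ℕ :=
  if n ≤ 3 then (n ^ 2 - n) / 2
  else if n = 6 then 30 else if n = 7 then 56 else if n = 8 then 112 else n ^ 2 - 2 * n

/-- The same bound for positive bigraphs with a positive sincere root. -/
def boundPosSincere (n : ℕ) : ℕ :=
  if n ≤ 3 then 0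
  else if n = 6 then 5 else if n = 7 then 10 else if n = 8 then 21 else n - 3

/-- `PosDefTestByInflations A s D r`: on the input `A` and the strategy `s`, the algorithm may
compute the bigraph `D` and return the answer `r`. -/
def PosDefTestByInflations {n : ℕ} (A : Matrix (Fin n) (Fin n) ℝ) (s : Fin 4)
    (D : Bigraph n) (r : Bool) : Prop :=
  Bigraph.InflationsAtPair s (boundPos n) (Bigraph.ofMatrix A) D ∧ (r = true ↔ D.IsDynkin)

/-- `PosDefTestByRootInflations A s D r`: on the input `A` and the strategy `s`, the algorithm
may compute the bigraph `D` and return the answer `r`. -/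
def PosDefTestByRootInflations {n : ℕ} [NeZero n] (A : Matrix (Fin n) (Fin n) ℝ) (s : Fin 4)
    (D : Bigraph n) (r : Bool) : Prop :=
  (∃ Δ', Bigraph.InflationsToPosSincereRoot (Bigraph.ofMatrix A) Δ' ∧
    Bigraph.InflationsAtPair s (boundPosSincere n) Δ' D) ∧ (r = true ↔ D.IsDynkin)

/-! ## The machine

A random access machine with unit cost.  It has finitely many registers and arrays of natural
numbers for indices and counters, a read-only input matrix and a working matrix of real
coefficients, and a source of random numbers.  Every access to a register, an array or a matrix,
every constant, every arithmetic operation, every comparison and every command costs one step. -/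

namespace Machine

/-- Names of registers. -/
inductive Var
  | n | strategy | i | j | a | b | c | k | m | q | limit | count | size
  | start | tries | pos | cur | next | best | score | good | result
  deriving DecidableEq

/-- Names of arrays. -/
inductive Arr
  | inS | deg | visited | label
  deriving DecidableEq

structure State where
  /-- registers -/
  reg : Var → ℕ
  /-- arrays of natural numbers -/
  arr : Arr → ℕ → ℕ
  /-- the input matrix -/
  inp : ℕ → ℕ → ℝ
  /-- the working matrix -/
  mat : ℕ → ℕ → ℝ
  /-- the random numbers that have not been used yet -/
  rnd : ℕ → ℕ

/-- Index expressions; `sub` is truncated. -/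
inductive NExpr
  | lit (k : ℕ)
  | var (x : Var)
  | arr (x : Arr) (e : NExpr)
  | add (e f : NExpr)
  | sub (e f : NExpr)
  | mul (e f : NExpr)
  | half (e : NExpr)
  | min (e f : NExpr)
  | max (e f : NExpr)

/-- Coefficient expressions. -/
inductive RExpr
  | lit (z : ℤ)
  | inp (e f : NExpr)
  | mat (e f : NExpr)
  | neg (u : RExpr)
  | add (u v : RExpr)
  | sub (u v : RExpr)
  | mul (u v : RExpr)

/-- Tests. -/
inductive BExpr
  | lt (e f : NExpr)
  | eq (e f : NExpr)
  | rlt (u v : RExpr)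
  | req (u v : RExpr)
  | not (p : BExpr)
  | and (p q : BExpr)
  | or (p q : BExpr)

/-- Commands. -/
inductive Cmd
  | skip
  | assign (x : Var) (e : NExpr)
  | store (x : Arr) (e f : NExpr)
  | storeMat (e f : NExpr) (u : RExpr)
  | choose (x : Var) (e : NExpr)
  | seq (p q : Cmd)
  | ite (t : BExpr) (p q : Cmd)
  | loop (t : BExpr) (p : Cmd)

namespace NExpr

def eval (σ : State) : NExpr → ℕ
  | lit k => k
  | var x => σ.reg x
  | arr x e => σ.arr x (e.eval σ)
  | add e f => e.eval σ + f.eval σ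
  | sub e f => e.eval σ - f.eval σ
  | mul e f => e.eval σ * f.eval σ
  | half e => e.eval σ / 2
  | min e f => Min.min (e.eval σ) (f.eval σ)
  | max e f => Max.max (e.eval σ) (f.eval σ)

def cost : NExpr → ℕ
  | lit _ => 1
  | var _ => 1
  | arr _ e => e.cost + 1
  | add e f => e.cost + f.cost + 1
  | sub e f => e.cost + f.cost + 1
  | mul e f => e.cost + f.cost + 1
  | half e => e.cost + 1
  | min e f => e.cost + f.cost + 1
  | max e f => e.cost + f.cost + 1

end NExpr

namespace RExpr

noncomputable def eval (σ : State) : RExpr → ℝ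
  | lit z => z
  | inp e f => σ.inp (e.eval σ) (f.eval σ)
  | mat e f => σ.mat (e.eval σ) (f.eval σ)
  | neg u => -u.eval σ
  | add u v => u.eval σ + v.eval σ
  | sub u v => u.eval σ - v.eval σ
  | mul u v => u.eval σ * v.eval σ

def cost : RExpr → ℕ
  | lit _ => 1
  | inp e f => e.cost + f.cost + 1
  | mat e f => e.cost + f.cost + 1
  | neg u => u.cost + 1
  | add u v => u.cost + v.cost + 1
  | sub u v => u.cost + v.cost + 1
  | mul u v => u.cost + v.cost + 1

end RExpr

namespace BExpr

def Holds (σ : State) : BExpr → Prop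
  | lt e f => e.eval σ < f.eval σ
  | eq e f => e.eval σ = f.eval σ
  | rlt u v => u.eval σ < v.eval σ
  | req u v => u.eval σ = v.eval σ
  | not p => ¬ p.Holds σ
  | and p q => p.Holds σ ∧ q.Holds σ
  | or p q => p.Holds σ ∨ q.Holds σ

def cost : BExpr → ℕ
  | lt e f => e.cost + f.cost + 1
  | eq e f => e.cost + f.cost + 1
  | rlt u v => u.cost + v.cost + 1
  | req u v => u.cost + v.cost + 1
  | not p => p.cost + 1
  | and p q => p.cost + q.cost + 1
  | or p q => p.cost + q.cost + 1

end BExpr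

/-- `Exec p σ τ t`: the command `p`, started in the state `σ`, halts in the state `τ` after `t`
steps.  The command `choose x e` draws the next random number and puts its residue modulo the
value of `e` into `x`; if that value is `0`, there is nothing to choose from, and the machine is
stuck. -/
inductive Exec : Cmd → State → State → ℕ → Prop
  | skip (σ) : Exec .skip σ σ 1
  | assign (x e σ) :
      Exec (.assign x e) σ { σ with reg := Function.update σ.reg x (e.eval σ) } (e.cost + 1)
  | store (x e f σ) :
      Exec (.store x e f) σ
        { σ with
          arr := Function.update σ.arr x (Function.update (σ.arr x) (e.eval σ) (f.eval σ)) }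
        (e.cost + f.cost + 1)
  | storeMat (e f u σ) :
      Exec (.storeMat e f u) σ
        { σ with
          mat := Function.update σ.mat (e.eval σ)
            (Function.update (σ.mat (e.eval σ)) (f.eval σ) (u.eval σ)) }
        (e.cost + f.cost + u.cost + 1)
  | choose (x e σ) : 0 < e.eval σ →
      Exec (.choose x e) σ
        { σ with
          reg := Function.update σ.reg x (σ.rnd 0 % e.eval σ)
          rnd := fun l => σ.rnd (l + 1) }
        (e.cost + 1)
  | seq (p q σ τ υ t u) : Exec p σ τ t → Exec q τ υ u → Exec (.seq p q) σ υ (t + u)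
  | ite_true (c p q σ τ t) : c.Holds σ → Exec p σ τ t → Exec (.ite c p q) σ τ (c.cost + 1 + t)
  | ite_false (c p q σ τ t) : ¬ c.Holds σ → Exec q σ τ t →
      Exec (.ite c p q) σ τ (c.cost + 1 + t)
  | loop_true (c p σ τ υ t u) : c.Holds σ → Exec p σ τ t → Exec (.loop c p) τ υ u →
      Exec (.loop c p) σ υ (c.cost + 1 + t + u)
  | loop_false (c p σ) : ¬ c.Holds σ → Exec (.loop c p) σ σ (c.cost + 1)

/-- The machine is deterministic once the random numbers are given. -/
theorem Exec.unique {p : Cmd} {σ τ : State} {t : ℕ} (h : Exec p σ τ t) :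
    ∀ {τ' : State} {t' : ℕ}, Exec p σ τ' t' → τ = τ' ∧ t = t' := by
  induction h with
  | skip => rintro _ _ ⟨⟩; exact ⟨rfl, rfl⟩
  | assign => rintro _ _ ⟨⟩; exact ⟨rfl, rfl⟩
  | store => rintro _ _ ⟨⟩; exact ⟨rfl, rfl⟩
  | storeMat => rintro _ _ ⟨⟩; exact ⟨rfl, rfl⟩
  | choose => rintro _ _ ⟨⟩; exact ⟨rfl, rfl⟩
  | seq p q σ τ υ t u _ _ ih1 ih2 =>
    intro _ _ h
    cases h with
    | seq _ _ _ _ _ _ _ h1 h2 =>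
      obtain ⟨rfl, rfl⟩ := ih1 h1
      obtain ⟨rfl, rfl⟩ := ih2 h2
      exact ⟨rfl, rfl⟩
  | ite_true c p q σ τ t hc _ ih =>
    intro _ _ h
    cases h with
    | ite_true _ _ _ _ _ _ _ h1 => obtain ⟨rfl, rfl⟩ := ih h1; exact ⟨rfl, rfl⟩
    | ite_false _ _ _ _ _ _ hn _ => exact absurd hc hn
  | ite_false c p q σ τ t hc _ ih =>
    intro _ _ h
    cases h with
    | ite_true _ _ _ _ _ _ hn _ => exact absurd hn hc
    | ite_false _ _ _ _ _ _ _ h1 => obtain ⟨rfl, rfl⟩ := ih h1; exact ⟨rfl, rfl⟩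
  | loop_true c p σ τ υ t u hc _ _ ih1 ih2 =>
    intro _ _ h
    cases h with
    | loop_true _ _ _ _ _ _ _ _ h1 h2 =>
      obtain ⟨rfl, rfl⟩ := ih1 h1
      obtain ⟨rfl, rfl⟩ := ih2 h2
      exact ⟨rfl, rfl⟩
    | loop_false _ _ _ hn => exact absurd hc hn
  | loop_false c p σ hc =>
    intro _ _ h
    cases h with
    | loop_true _ _ _ _ _ _ _ hn => exact absurd hn hc
    | loop_false => exact ⟨rfl, rfl⟩

/-- The initial state for the input matrix `A`, the strategy `s` and the random numbers `ω`. -/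
noncomputable def initial {n : ℕ} (A : Matrix (Fin n) (Fin n) ℝ) (s : Fin 4) (ω : ℕ → ℕ) :
    State where
  reg x := match x with
    | .n => n
    | .strategy => s
    | _ => 0
  arr _ _ := 0
  inp i j := if h : i < n ∧ j < n then A ⟨i, h.1⟩ ⟨j, h.2⟩ else 0
  mat _ _ := 0
  rnd := ω

/-! ## The programs

The machine stores a bigraph as its upper triangular Gram matrix (in the working matrix). -/

infixr:60 " ;; " => Cmd.seq

instance : Coe Var NExpr := ⟨NExpr.var⟩

instance (k : ℕ) : OfNat NExpr k := ⟨NExpr.lit k⟩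

/-- The coefficient of the unordered pair of vertices `e`, `f`. -/
def edge (e f : NExpr) : RExpr := .mat (.min e f) (.max e f)

/-- Change the coefficient of the unordered pair of vertices `e`, `f`. -/
def setEdge (e f : NExpr) (u : RExpr) : Cmd := .storeMat (.min e f) (.max e f) u

/-- Run `p` for `x = 0, …, n - 1`. -/
def forAll (x : Var) (p : Cmd) : Cmd :=
  .assign x 0 ;; .loop (.lt x Var.n) (p ;; .assign x (.add x 1))

/-- `x := x + 1` -/
def incr (x : Var) : Cmd := .assign x (.add x 1)

section Programs

open Var Arr

/-- Write the triangularisation of the input matrix into the working matrix. -/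
def gramProg : Cmd :=
  forAll i (forAll j (
    .ite (.lt i j) (.storeMat i j (.add (.inp i j) (.inp j i)))
      (.ite (.eq i j) (.storeMat i i (.inp i i)) (.storeMat i j (.lit 0)))))

/-- Count the pairs `(i, j)` that pass the test `t`; the result is in `m`. -/
def countPairs (t : BExpr) : Cmd :=
  .assign m 0 ;; forAll i (forAll j (.ite t (incr m) .skip))

/-- Find the pair number `k` (counted from `0`, in the lexicographic order) among the pairs
`(i, j)` that pass the test `t`, and put it into `(a, b)`. -/
def findPair (t : BExpr) : Cmd :=
  .assign q 0 ;;
  forAll i (forAll j (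
    .ite t (.ite (.eq q k) (.assign a i ;; .assign b j) .skip ;; incr q) .skip))

/-- `i < j`, and `i`, `j` are joined by dotted edges. -/
def dottedTest : BExpr := .and (.lt i j) (.rlt (.lit 0) (.mat i j))

/-- `i ∈ S`, `j ∉ S`, and some edge joins `i` and `j`. -/
def crossingTest : BExpr :=
  .and (.and (.eq (.arr inS i) 1) (.eq (.arr inS j) 0)) (.not (.req (edge i j) (.lit 0)))

/-- Inflation at the vertex `x`. -/
def inflateVertexProg (x : Var) : Cmd :=
  forAll c (.ite (.eq c x) .skip (setEdge x c (.neg (edge x c))))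

/-- Inflation at the pair `(x, y)`. -/
def inflatePairProg (x y : Var) : Cmd :=
  forAll c (.ite (.or (.eq c x) (.eq c y)) .skip
    (setEdge y c (.sub (edge y c) (.mul (edge x c) (edge x y))))) ;;
  setEdge x y (.neg (edge x y))

/-- Select a dotted edge with respect to the strategy, out of `m > 0` pairs. -/
def selectProg : Cmd :=
  .ite (.eq strategy 0) (.assign k 0)
    (.ite (.eq strategy 1) (.assign k (.sub m 1))
      (.ite (.eq strategy 2)
        (.choose c 2 ;; .ite (.eq c 0) (.assign k 0) (.assign k (.sub m 1)))
        (.choose k m))) ;;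
  findPair dottedTest

/-- Inflations at pairs, as long as there are dotted edges, but at most `limit` times. -/
def inflationsAtPairProg : Cmd :=
  .assign count 0 ;;
  countPairs dottedTest ;;
  .loop (.and (.lt 0 m) (.lt count limit))
    (selectProg ;; inflatePairProg a b ;; incr count ;; countPairs dottedTest)

/-- The inflations that make a positive sincere root appear. -/
def rootProg : Cmd :=
  forAll i (.store inS i 0) ;;
  .store inS 0 1 ;;
  .assign size 1 ;;
  .loop (.lt size Var.n)
    (countPairs crossingTest ;;
      .choose k m ;;
      findPair crossingTest ;;
      .ite (.rlt (.lit 0) (edge a b)) .skip (inflateVertexProg b) ;;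
      inflatePairProg b a ;;
      .store inS b 1 ;;
      incr size)

/-- Compute the degrees of all vertices. -/
def degreesProg : Cmd :=
  forAll i (.store deg i 0 ;;
    forAll j (.ite (.or (.eq i j) (.req (edge i j) (.lit 0))) .skip
      (.store deg i (.add (.arr deg i) 1))))

/-- List all the vertices, beginning with `start`: each next one is an unvisited neighbour of the
current one, of the largest possible degree (any unvisited vertex if there is no such neighbour). -/
def labelProg : Cmd :=
  forAll i (.store visited i 0) ;;
  .store label 0 start ;;
  .store visited start 1 ;;
  .assign pos 1 ;;
  .loop (.lt pos Var.n)
    (.assign cur (.arr label (.sub pos 1)) ;;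
      .assign best 0 ;;
      forAll j (.ite (.eq (.arr visited j) 0)
        (.ite (.req (edge cur j) (.lit 0)) (.assign score 0) (.assign score (.arr deg j)) ;;
          .ite (.lt score best) .skip (.assign next j ;; .assign best score))
        .skip) ;;
      .store label pos next ;;
      .store visited next 1 ;;
      incr pos)

/-- Set `result` to `1` if the list of the vertices identifies the bigraph with the path through
the first `n - 1` of them, extended by one solid edge from the last one to the vertex number `k`. -/
def compareProg : Cmd :=
  .assign good 1 ;;
  forAll i (forAll j (.ite (.lt i j)
    (.ite
      (.or (.and (.eq j (.add i 1)) (.lt (.add j 1) Var.n)) (.and (.eq (.add j 1) Var.n) (.eq i k)))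
      (.ite (.req (edge (.arr label i) (.arr label j)) (.lit (-1))) .skip (.assign good 0))
      (.ite (.req (edge (.arr label i) (.arr label j)) (.lit 0)) .skip (.assign good 0)))
    .skip)) ;;
  .ite (.eq good 1) (.assign result 1) .skip

/-- Set `result` to `1` if the bigraph is a Dynkin graph, and to `0` otherwise.  A Dynkin graph
has at most three vertices of degree less than `2`, so three attempts are enough. -/
def dynkinProg : Cmd :=
  degreesProg ;;
  .assign result 0 ;;
  .assign tries 0 ;;
  forAll start (.ite (.and (.lt (.arr deg start) 2) (.lt tries 3))
    (incr tries ;;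
      labelProg ;;
      .assign k (.sub Var.n 2) ;;
      compareProg ;;
      .ite (.lt 3 Var.n) (.assign k 1 ;; compareProg) .skip ;;
      .ite (.and (.lt 5 Var.n) (.lt Var.n 9)) (.assign k 2 ;; compareProg) .skip)
    .skip)

/-- `limit := boundPos n` -/
def boundPosProg : Cmd :=
  .ite (.lt Var.n 4) (.assign limit (.half (.sub (.mul Var.n Var.n) Var.n)))
    (.ite (.eq Var.n 6) (.assign limit 30)
      (.ite (.eq Var.n 7) (.assign limit 56)
        (.ite (.eq Var.n 8) (.assign limit 112)
          (.assign limit (.sub (.mul Var.n Var.n) (.mul 2 Var.n))))))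

/-- `limit := boundPosSincere n` -/
def boundPosSincereProg : Cmd :=
  .ite (.lt Var.n 4) (.assign limit 0)
    (.ite (.eq Var.n 6) (.assign limit 5)
      (.ite (.eq Var.n 7) (.assign limit 10)
        (.ite (.eq Var.n 8) (.assign limit 21) (.assign limit (.sub Var.n 3)))))

/-- The algorithm `PosDefTestByInflations`. -/
def posDefTestByInflationsProg : Cmd :=
  gramProg ;; boundPosProg ;; inflationsAtPairProg ;; dynkinProg

/-- The algorithm `PosDefTestByRootInflations`. -/
def posDefTestByRootInflationsProg : Cmd :=
  gramProg ;; rootProg ;; boundPosSincereProg ;; inflationsAtPairProg ;; dynkinProg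

end Programs

/-- The working matrix of `σ` stores the upper triangular Gram matrix of the bigraph `D`. -/
def Stores {n : ℕ} (σ : State) (D : Bigraph n) : Prop :=
  ∀ i j : Fin n, σ.mat i j = if i < j then (D.d i j : ℝ) else if i = j then 1 else 0

end Machine

/-! The time bounds come from a count of scans. On the stored upper triangle an inflation touches
one row and column, so it costs O(n). Counting the dotted pairs and finding the one of prescribed
rank are scans of n² cells. One pass of the inflation loop therefore costs O(n²). The number of
passes is capped by `boundPos n` = O(n²) or `boundPosSincere n` = O(n), which gives O(n⁴) and O(n³).
The root procedure makes n - 1 passes of two scans each, again O(n³). Building the Gram matrix costs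
O(n²), and the final recognition fits into O(n³).

Correctness is proved together with time. `Runs p σ T Q` is a total-correctness triple with a time
bound, and `Frame` supplies for free everything that a command cannot write. Loops use invariants
ranked by a number that bounds the remaining passes. Random draws enter only through "the value is
below the bound", so the result holds for every random stream (`Runs.choose`).

Three mathematical points carry the rest. Pairs are numbered in row-major order, which is the
lexicographic order, so the strategies become statements about the rank of a dotted pair
(`selects_of_admissible`). Connectedness survives inflations (`Connected.inflatePair`), so the root
procedure always finds an edge leaving S and its random choice is never made from an empty range.

Finally, every Dynkin graph is a path on n - 1 vertices with one more vertex attached at position k.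
A greedy walk that starts at the free end of the path and prefers neighbours of large degree
recovers this shape (`GreedyList.matches`). At most three vertices have degree below 2, so three
attempts include that end (`card_deg_lt_two_le`). Conversely, a successful comparison is itself an
isomorphism (`Matches.isDynkin`). -/

/-! ## Total correctness with time bounds -/

namespace Machine

/-! ### Elementary updates of machine states. -/

namespace State

/-- Put `v` into the register `x`. -/
def setReg (σ : State) (x : Var) (v : ℕ) : State :=
  { σ with reg := Function.update σ.reg x v }

/-- Put `v` into the cell `k` of the array `x`. -/
def setArr (σ : State) (x : Arr) (k v : ℕ) : State :=
  { σ with arr := Function.update σ.arr x (Function.update (σ.arr x) k v) }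

/-- Put `v` into the cell `(i, j)` of the working matrix. -/
def setMat (σ : State) (i j : ℕ) (v : ℝ) : State :=
  { σ with mat := Function.update σ.mat i (Function.update (σ.mat i) j v) }

variable (σ : State)

@[simp] theorem reg_setReg (x y : Var) (v : ℕ) :
    (σ.setReg x v).reg y = if y = x then v else σ.reg y := by
  simp [setReg, Function.update_apply]

@[simp] theorem arr_setReg (x : Var) (v : ℕ) : (σ.setReg x v).arr = σ.arr := rfl
@[simp] theorem mat_setReg (x : Var) (v : ℕ) : (σ.setReg x v).mat = σ.mat := rfl

@[simp] theorem arr_setArr (x y : Arr) (k v l : ℕ) :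
    (σ.setArr x k v).arr y l = if y = x ∧ l = k then v else σ.arr y l := by
  by_cases h : y = x
  · subst h; simp [setArr, Function.update_apply]
  · simp [setArr, h]

@[simp] theorem reg_setArr (x : Arr) (k v : ℕ) : (σ.setArr x k v).reg = σ.reg := rfl
@[simp] theorem mat_setArr (x : Arr) (k v : ℕ) : (σ.setArr x k v).mat = σ.mat := rfl

@[simp] theorem mat_setMat (i j k l : ℕ) (v : ℝ) :
    (σ.setMat i j v).mat k l = if k = i ∧ l = j then v else σ.mat k l := by
  by_cases h : k = i
  · subst h; simp [setMat, Function.update_apply]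
  · simp [setMat, h]

@[simp] theorem reg_setMat (i j : ℕ) (v : ℝ) : (σ.setMat i j v).reg = σ.reg := rfl
@[simp] theorem arr_setMat (i j : ℕ) (v : ℝ) : (σ.setMat i j v).arr = σ.arr := rfl

end State

/-! ### Straight-line commands and the footprint of a command. -/

namespace Cmd

open Classical in
/-- The effect of a command without loops and random choices. -/
noncomputable def run : Cmd → State → State
  | skip, σ => σ
  | assign x e, σ => σ.setReg x (e.eval σ)
  | store x e f, σ => σ.setArr x (e.eval σ) (f.eval σ)
  | storeMat e f u, σ => σ.setMat (e.eval σ) (f.eval σ) (u.eval σ)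
  | choose _ _, σ => σ
  | seq p q, σ => q.run (p.run σ)
  | ite t p q, σ => if t.Holds σ then p.run σ else q.run σ
  | loop _ _, σ => σ

/-- The command has neither loops nor random choices. -/
def basic : Cmd → Bool
  | choose _ _ => false
  | seq p q => p.basic && q.basic
  | ite _ p q => p.basic && q.basic
  | loop _ _ => false
  | _ => true

/-- An upper bound for the time of a command without loops. -/
def maxCost : Cmd → ℕ
  | skip => 1
  | assign _ e => e.cost + 1
  | store _ e f => e.cost + f.cost + 1
  | storeMat e f u => e.cost + f.cost + u.cost + 1
  | choose _ e => e.cost + 1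
  | seq p q => p.maxCost + q.maxCost
  | ite t p q => t.cost + 1 + (p.maxCost + q.maxCost)
  | loop _ _ => 0

/-- The command may write the register `x`. -/
def setsReg : Cmd → Var → Bool
  | assign y _, x => x == y
  | choose y _, x => x == y
  | seq p q, x => p.setsReg x || q.setsReg x
  | ite _ p q, x => p.setsReg x || q.setsReg x
  | loop _ p, x => p.setsReg x
  | _, _ => false

/-- The command may write the array `x`. -/
def setsArr : Cmd → Arr → Bool
  | store y _ _, x => x == y
  | seq p q, x => p.setsArr x || q.setsArr x
  | ite _ p q, x => p.setsArr x || q.setsArr x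
  | loop _ p, x => p.setsArr x
  | _, _ => false

/-- The command may write the working matrix. -/
def setsMat : Cmd → Bool
  | storeMat _ _ _ => true
  | seq p q => p.setsMat || q.setsMat
  | ite _ p q => p.setsMat || q.setsMat
  | loop _ p => p.setsMat
  | _ => false

end Cmd

/-- `σ` and `τ` differ only in places that `p` may write. -/
structure Frame (p : Cmd) (σ τ : State) : Prop where
  reg : ∀ x, p.setsReg x = false → τ.reg x = σ.reg x
  arr : ∀ x, p.setsArr x = false → τ.arr x = σ.arr x
  mat : p.setsMat = false → τ.mat = σ.mat
  inp : τ.inp = σ.inp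

theorem Frame.refl (p : Cmd) (σ : State) : Frame p σ σ :=
  ⟨fun _ _ => rfl, fun _ _ => rfl, fun _ => rfl, rfl⟩

theorem Frame.trans {p : Cmd} {σ τ υ : State} (h : Frame p σ τ) (h' : Frame p τ υ) :
    Frame p σ υ :=
  ⟨fun x hx => (h'.reg x hx).trans (h.reg x hx), fun x hx => (h'.arr x hx).trans (h.arr x hx),
    fun hx => (h'.mat hx).trans (h.mat hx), h'.inp.trans h.inp⟩

theorem Frame.mono {p q : Cmd} {σ τ : State} (h : Frame p σ τ)
    (hr : ∀ x, q.setsReg x = false → p.setsReg x = false)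
    (ha : ∀ x, q.setsArr x = false → p.setsArr x = false)
    (hm : q.setsMat = false → p.setsMat = false) : Frame q σ τ :=
  ⟨fun x hx => h.reg x (hr x hx), fun x hx => h.arr x (ha x hx), fun hx => h.mat (hm hx), h.inp⟩

theorem Frame.setReg {p : Cmd} {σ τ : State} (h : Frame p σ τ) {x : Var} (v : ℕ)
    (hx : p.setsReg x = true) : Frame p σ (τ.setReg x v) := by
  refine ⟨fun y hy => ?_, h.arr, h.mat, h.inp⟩
  have : y ≠ x := by rintro rfl; simp [hx] at hy
  simp [this, h.reg y hy]

/-- Induction on the execution: each command writes only where its syntax says. For concrete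
registers and programs the side conditions compute to `false`, so later proofs discharge them by
`rfl`. -/
theorem Exec.frame {p : Cmd} {σ τ : State} {t : ℕ} (h : Exec p σ τ t) : Frame p σ τ := by
  induction h with
  | skip σ => exact Frame.refl _ _
  | assign x e σ =>
    refine ⟨fun y hy => ?_, fun _ _ => rfl, fun _ => rfl, rfl⟩
    have : y ≠ x := by simpa [Cmd.setsReg] using hy
    simp [this]
  | store x e f σ =>
    refine ⟨fun _ _ => rfl, fun y hy => ?_, fun _ => rfl, rfl⟩
    have : y ≠ x := by simpa [Cmd.setsArr] using hy
    simp [this]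
  | storeMat e f u σ =>
    refine ⟨fun _ _ => rfl, fun _ _ => rfl, fun h => ?_, rfl⟩
    simp [Cmd.setsMat] at h
  | choose x e σ =>
    refine ⟨fun y hy => ?_, fun _ _ => rfl, fun _ => rfl, rfl⟩
    have : y ≠ x := by simpa [Cmd.setsReg] using hy
    simp [this]
  | seq p q σ τ υ t u _ _ h1 h2 =>
    apply (h1.mono ..).trans (h2.mono ..) <;>
      simp +contextual [Cmd.setsReg, Cmd.setsArr, Cmd.setsMat]
  | ite_true c p q σ τ t _ _ h1 =>
    apply h1.mono <;> simp +contextual [Cmd.setsReg, Cmd.setsArr, Cmd.setsMat]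
  | ite_false c p q σ τ t _ _ h1 =>
    apply h1.mono <;> simp +contextual [Cmd.setsReg, Cmd.setsArr, Cmd.setsMat]
  | loop_true c p σ τ υ t u _ _ _ h1 h2 =>
    refine (h1.mono ?_ ?_ ?_).trans h2 <;>
      simp +contextual [Cmd.setsReg, Cmd.setsArr, Cmd.setsMat]
  | loop_false => exact Frame.refl _ _

/-- `p`, started in `σ`, halts after at most `T` steps in a state that satisfies `Q`. -/
def Runs (p : Cmd) (σ : State) (T : ℕ) (Q : State → Prop) : Prop :=
  ∃ τ t, Exec p σ τ t ∧ t ≤ T ∧ Q τ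

/-! ### Proof rules for timed total correctness. -/

namespace Runs

variable {p q : Cmd} {σ : State} {T U V : ℕ} {Q Q' : State → Prop}

/-- The frame is handed to the consequence step (and likewise in `seq`), so a specification only has
to describe what a command computes, not what it preserves. -/
theorem imp (h : Runs p σ T Q) (hQ : ∀ τ, Frame p σ τ → Q τ → Q' τ) : Runs p σ T Q' := by
  obtain ⟨τ, t, h1, h2, h3⟩ := h
  exact ⟨τ, t, h1, h2, hQ τ h1.frame h3⟩

theorem mono (h : Runs p σ T Q) (hT : T ≤ U) : Runs p σ U Q := by
  obtain ⟨τ, t, h1, h2, h3⟩ := h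
  exact ⟨τ, t, h1, h2.trans hT, h3⟩

theorem seq (h : Runs p σ T Q') (h' : ∀ τ, Frame p σ τ → Q' τ → Runs q τ U Q) :
    Runs (p ;; q) σ (T + U) Q := by
  obtain ⟨τ, t, h1, h2, h3⟩ := h
  obtain ⟨υ, u, h4, h5, h6⟩ := h' τ h1.frame h3
  exact ⟨υ, _, .seq _ _ _ _ _ _ _ h1 h4, by omega, h6⟩

theorem ite {c : BExpr} (h : c.Holds σ → Runs p σ T Q) (h' : ¬ c.Holds σ → Runs q σ T Q) :
    Runs (.ite c p q) σ (c.cost + 1 + T) Q := by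
  by_cases hc : c.Holds σ
  · obtain ⟨τ, t, h1, h2, h3⟩ := h hc
    exact ⟨τ, _, .ite_true _ _ _ _ _ _ hc h1, by omega, h3⟩
  · obtain ⟨τ, t, h1, h2, h3⟩ := h' hc
    exact ⟨τ, _, .ite_false _ _ _ _ _ _ hc h1, by omega, h3⟩

/-- Straight-line code is settled by simplifying the state that `run` computes; its time bound is
then a numeral. -/
theorem basic : ∀ {p : Cmd} {σ : State} {Q : State → Prop}, p.basic = true → Q (p.run σ) →
    Runs p σ p.maxCost Q := by
  intro p
  induction p with
  | skip => exact fun _ h => ⟨_, _, .skip _, le_rfl, h⟩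
  | assign x e => exact fun _ h => ⟨_, _, .assign _ _ _, le_rfl, h⟩
  | store x e f => exact fun _ h => ⟨_, _, .store _ _ _ _, le_rfl, h⟩
  | storeMat e f u => exact fun _ h => ⟨_, _, .storeMat _ _ _ _, le_rfl, h⟩
  | choose x e => intro _ _ h; simp [Cmd.basic] at h
  | seq p q hp hq =>
    intro σ Q h hQ
    simp only [Cmd.basic, Bool.and_eq_true] at h
    exact (hp (Q := (· = p.run σ)) h.1 rfl).seq fun τ _ hτ => hq h.2 (by rw [hτ]; exact hQ)
  | ite c p q hp hq =>
    intro σ Q h hQ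
    simp only [Cmd.basic, Bool.and_eq_true] at h
    refine ite (fun hc => (hp h.1 ?_).mono (Nat.le_add_right _ _))
      (fun hc => (hq h.2 ?_).mono (Nat.le_add_left _ _)) <;> simpa [Cmd.run, hc] using hQ
  | loop c p => intro _ _ h; simp [Cmd.basic] at h

/-- All that is remembered about the draw is its range, which makes every conclusion uniform in the
random numbers. Positivity of the range keeps the machine from being stuck. -/
theorem choose {x : Var} {e : NExpr} (he : 0 < e.eval σ)
    (h : ∀ τ : State, τ.reg x < e.eval σ → Q τ) : Runs (.choose x e) σ (e.cost + 1) Q :=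
  ⟨_, _, .choose _ _ _ he, le_rfl, h _ (by simpa using Nat.mod_lt _ he)⟩

/-- The index of the invariant is a rank that each pass must lower, so the initial rank bounds the
number of passes; one more failing test ends the loop. -/
theorem loop {c : BExpr} {I : ℕ → State → Prop} (r : ℕ)
    (hs : ∀ k τ, I k τ → c.Holds τ → ∃ l < k, Runs p τ T (I l))
    (hQ : ∀ k τ, I k τ → ¬ c.Holds τ → Q τ) (h0 : I r σ) :
    Runs (.loop c p) σ (r * (c.cost + 1 + T) + (c.cost + 1)) Q := by
  induction r using Nat.strong_induction_on generalizing σ with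
  | _ r ih =>
    by_cases hc : c.Holds σ
    · obtain ⟨l, hl, τ, t, h1, h2, h3⟩ := hs r σ h0 hc
      obtain ⟨υ, u, h4, h5, h6⟩ := ih l hl h3
      refine ⟨υ, _, .loop_true _ _ _ _ _ _ _ hc h1 h4, ?_, h6⟩
      have : (l + 1) * (c.cost + 1 + T) ≤ r * (c.cost + 1 + T) := Nat.mul_le_mul_right _ hl
      rw [add_mul, one_mul] at this
      omega
    · exact ⟨σ, _, .loop_false _ _ _ hc, by omega, hQ r σ h0 hc⟩

/-- A loop over all vertices whose body leaves the counter and the number of vertices alone. -/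
theorem forAll {x : Var} {N : ℕ} (I : ℕ → State → Prop) (hN : σ.reg .n = N) (h1 : 1 ≤ N)
    (hx : (p.setsReg x || p.setsReg .n || x == .n) = false) (h0 : I 0 (σ.setReg x 0))
    (hs : ∀ k < N, ∀ τ, τ.reg x = k → τ.reg .n = N → Frame (forAll x p) σ τ → I k τ →
      Runs p τ T fun υ => I (k + 1) (υ.setReg x (k + 1))) :
    Runs (Machine.forAll x p) σ (N * (T + 14)) (I N) := by
  simp only [Bool.or_eq_false_iff, beq_eq_false_iff_ne] at hx
  obtain ⟨⟨hx1, hx2⟩, hx3⟩ := hx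
  have hfx : (Machine.forAll x p).setsReg x = true := by simp [Machine.forAll, Cmd.setsReg]
  -- Here 2 pays for resetting the counter, 4 for a test, and `T + 4` for the body with its
  -- increment; the last 4 is the failing test. The surplus 6 is absorbed into N passes because `1 ≤
  -- N`.
  refine mono (T := 2 + (N * (4 + (T + 4)) + 4)) ?_ (by nlinarith)
  refine seq (Q' := fun τ => τ = σ.setReg x 0) (basic rfl rfl) ?_
  rintro τ - rfl
  refine loop (c := .lt x Var.n) (I := fun r τ => ∃ k, k + r = N ∧ τ.reg x = k ∧ τ.reg .n = N ∧
    Frame (Machine.forAll x p) σ τ ∧ I k τ) N ?_ ?_ ?_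
  · rintro r τ ⟨k, hk, hk1, hk2, hk3, hk4⟩ hc
    have hkN : k < N := by simpa [BExpr.Holds, NExpr.eval, hk1, hk2] using hc
    refine ⟨r - 1, by omega, seq (hs k hkN τ hk1 hk2 hk3 hk4) fun υ hυ hI => basic rfl ?_⟩
    have hυx : υ.reg x = k := (hυ.reg x hx1).trans hk1
    refine ⟨k + 1, by omega, by simp [Cmd.run, NExpr.eval, hυx], ?_, ?_, ?_⟩
    · simp [Cmd.run, Ne.symm hx3, hυ.reg _ hx2, hk2]
    · refine Frame.setReg ?_ _ hfx
      refine hk3.trans (hυ.mono ?_ ?_ ?_) <;>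
        simp +contextual [Machine.forAll, Cmd.setsReg, Cmd.setsArr, Cmd.setsMat]
    · simpa [Cmd.run, NExpr.eval, hυx] using hI
  · rintro r τ ⟨k, hk, hk1, hk2, hk3, hk4⟩ hc
    have hkN : ¬ k < N := by simpa [BExpr.Holds, NExpr.eval, hk1, hk2] using hc
    obtain rfl : k = N := by omega
    exact hk4
  · exact ⟨0, by omega, by simp, by simp [Ne.symm hx3, hN], (Frame.refl _ _).setReg _ hfx, h0⟩

/-- The row-major number of the current pair indexes one invariant for both loops. The end of row k
is the start of row k + 1, and since the counters change in between, the invariant must not depend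
on them. -/
theorem forAll_pair {N : ℕ} (I : ℕ → State → Prop) (hN : σ.reg .n = N) (h1 : 1 ≤ N)
    (hx : (p.setsReg .i || p.setsReg .j || p.setsReg .n) = false)
    (hI : ∀ k τ x v, I k τ → (x = .i ∨ x = .j) → I k (τ.setReg x v)) (h0 : I 0 σ)
    (hs : ∀ k l τ, k < N → l < N → τ.reg .i = k → τ.reg .j = l → τ.reg .n = N →
      Frame (Machine.forAll .i (Machine.forAll .j p)) σ τ → I (k * N + l) τ →
      Runs p τ T (I (k * N + l + 1))) :
    Runs (Machine.forAll .i (Machine.forAll .j p)) σ (N ^ 2 * (T + 28)) (I (N * N)) := by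
  simp only [Bool.or_eq_false_iff] at hx
  obtain ⟨⟨hx1, hx2⟩, hx3⟩ := hx
  refine mono (T := N * (N * (T + 14) + 14)) ?_ (by nlinarith)
  refine forAll (fun k τ => I (k * N) τ) hN h1 ?_ ?_ ?_
  · simp [Machine.forAll, Cmd.setsReg, hx1, hx3]
  · simpa using hI 0 σ .i 0 h0 (.inl rfl)
  intro k hk τ hτi hτn hf hτ
  refine imp (Q := fun υ => I (k * N + N) υ) ?_ fun υ _ hυ => by
    rw [Nat.succ_mul]; exact hI _ _ _ _ hυ (.inl rfl)
  refine forAll (fun l τ => I (k * N + l) τ) hτn h1 ?_ ?_ ?_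
  · simp [hx2, hx3]
  · exact hI _ _ _ _ hτ (.inr rfl)
  intro l hl υ hυj hυn hf' hυ
  refine imp (hs k l υ hk hl ?_ hυj hυn ?_ hυ) fun _ _ h => hI _ _ _ _ h (.inr rfl)
  · rw [hf'.reg, hτi]
    simp [Machine.forAll, Cmd.setsReg, hx1]
  · refine hf.trans (hf'.mono ?_ ?_ ?_) <;>
      simp +contextual [Machine.forAll, Cmd.setsReg, Cmd.setsArr, Cmd.setsMat]

end Runs

end Machine

/-! ### Changing one coefficient, and connectedness under inflations. -/

namespace Bigraph

variable {n : ℕ}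

/-- Replace the coefficient of the pair `a ≠ b`. -/
def setEdge (D : Bigraph n) {a b : Fin n} (hab : a ≠ b) (v : ℤ) : Bigraph n where
  d i j := if (i = a ∧ j = b) ∨ (i = b ∧ j = a) then v else D.d i j
  symm i j := by
    have : ((i = a ∧ j = b) ∨ (i = b ∧ j = a)) ↔ ((j = a ∧ i = b) ∨ (j = b ∧ i = a)) := by tauto
    simp only [this, D.symm i j]
  loopless i := by
    have : ¬ ((i = a ∧ i = b) ∨ (i = b ∧ i = a)) := by
      rintro (⟨rfl, h⟩ | ⟨rfl, h⟩) <;> simp_all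
    simp [this, D.loopless]

theorem underlying_adj (Δ : Bigraph n) (a b : Fin n) : Δ.underlying.Adj a b ↔ Δ.d a b ≠ 0 :=
  Iff.rfl

/-- Each edge of a walk in `Δ` is replaced by a walk in `Δ'`. -/
theorem Connected.of_reachable {Δ Δ' : Bigraph n} (h : Δ.Connected)
    (h' : ∀ a b, Δ.d a b ≠ 0 → Δ'.underlying.Reachable a b) : Δ'.Connected := by
  have : Nonempty (Fin n) := h.nonempty
  refine ⟨fun u v => ?_⟩
  obtain ⟨w⟩ := h.preconnected u v
  induction w with
  | nil => exact .refl _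
  | cons hadj _ ih => exact (h' _ _ hadj).trans ih

theorem Connected.inflateVertex {Δ : Bigraph n} (h : Δ.Connected) (a : Fin n) :
    (Δ.inflateVertex a).Connected := by
  refine h.of_reachable fun i j hij => SimpleGraph.Adj.reachable ?_
  simp only [underlying_adj, Bigraph.inflateVertex]
  split_ifs <;> simpa using hij

/-- Only edges at b change. If an edge b–j disappears, then d_bj = d_aj d_ab, so d_aj ≠ 0; the edges
b–a and a–j survive and give a detour. -/
theorem Connected.inflatePair {Δ : Bigraph n} (h : Δ.Connected) {a b : Fin n}
    (hab : Δ.d a b ≠ 0) : (Δ.inflatePair a b).Connected := by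
  have hne : a ≠ b := by rintro rfl; exact hab (Δ.loopless a)
  have h1 : (Δ.inflatePair a b).underlying.Adj a b := by
    simpa [underlying_adj, Bigraph.inflatePair, hne] using hab
  have key : ∀ j, Δ.d b j ≠ 0 → (Δ.inflatePair a b).underlying.Reachable b j := by
    intro j hj
    have hjb : b ≠ j := by rintro rfl; exact hj (Δ.loopless _)
    by_cases hja : j = a
    · subst hja; exact h1.reachable.symm
    by_cases h0 : (Δ.inflatePair a b).d b j = 0
    · have h2 : (Δ.inflatePair a b).underlying.Adj a j := by
        rw [underlying_adj]
        intro h3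
        simp [Bigraph.inflatePair, hne, Ne.symm hja, hjb, hne.symm, hja, Ne.symm hjb] at h0 h3
        rw [h3] at h0
        simp at h0
        exact hj h0
      exact h1.reachable.symm.trans h2.reachable
    · exact SimpleGraph.Adj.reachable h0
  refine h.of_reachable fun i j hij => ?_
  by_cases hib : i = b
  · subst hib; exact key j hij
  by_cases hjb : j = b
  · subst hjb; exact (key i (by rwa [Δ.symm])).symm
  refine SimpleGraph.Adj.reachable ?_
  have hij' : i ≠ j := by rintro rfl; exact hij (Δ.loopless _)
  simpa [underlying_adj, Bigraph.inflatePair, hib, hjb, hij'] using hij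

/-- A walk from a vertex of S to one outside has a step that leaves S. This makes the range of the
random choice in `rootProg` nonempty. -/
theorem Connected.exists_crossing {Δ : Bigraph n} (h : Δ.Connected) {S : Finset (Fin n)}
    (h0 : S.Nonempty) (h1 : S.card < n) : ∃ a ∈ S, ∃ b ∉ S, Δ.d a b ≠ 0 := by
  obtain ⟨u, hu⟩ := h0
  have : ∃ v, v ∉ S := by
    by_contra! hv
    rw [Finset.eq_univ_iff_forall.2 hv] at h1
    simp at h1
  obtain ⟨v, hv⟩ := this
  obtain ⟨w⟩ := h.preconnected u v
  obtain ⟨d, -, hd1, hd2⟩ := w.exists_boundary_dart (S : Set (Fin n)) (by simpa) (by simpa)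
  exact ⟨d.fst, by simpa using hd1, d.snd, by simpa using hd2, d.adj⟩

end Bigraph

namespace Machine

open Var Arr

/-! ## Access to the stored bigraph -/

section Stores

variable {n : ℕ} {σ τ : State} {D : Bigraph n}

theorem Stores.congr (h : Stores σ D) (hm : τ.mat = σ.mat) : Stores τ D := by
  intro i j; rw [hm]; exact h i j

theorem Stores.mat_lt (h : Stores σ D) {i j : Fin n} (hij : i < j) : σ.mat i j = D.d i j := by
  rw [h i j, if_pos hij]

theorem Stores.mat_min_max (h : Stores σ D) {a b : Fin n} (hab : a ≠ b) :
    σ.mat (min (a : ℕ) b) (max (a : ℕ) b) = D.d a b := by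
  rcases lt_or_gt_of_ne hab with hlt | hlt
  · have : (a : ℕ) < b := hlt
    rw [min_eq_left this.le, max_eq_right this.le, h.mat_lt hlt]
  · have : (b : ℕ) < a := hlt
    rw [min_eq_right this.le, max_eq_left this.le, h.mat_lt hlt, D.symm]

theorem Stores.eval_edge (h : Stores σ D) {e f : NExpr} {a b : Fin n} (he : e.eval σ = a)
    (hf : f.eval σ = b) (hab : a ≠ b) : (edge e f).eval σ = D.d a b := by
  simp only [edge, RExpr.eval, NExpr.eval, he, hf]
  exact h.mat_min_max hab

/-- The cell written is (min, max) of two distinct vertices, hence strictly above the diagonal; the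
unit diagonal and the zeros below it stay intact. -/
theorem Stores.run_setEdge (h : Stores σ D) {e f : NExpr} {u : RExpr} {a b : Fin n} {v : ℤ}
    (he : e.eval σ = a) (hf : f.eval σ = b) (hab : a ≠ b) (hu : u.eval σ = v) :
    Stores ((setEdge e f u).run σ) (D.setEdge hab v) := by
  intro i j
  simp only [setEdge, Cmd.run, NExpr.eval, he, hf, hu, State.mat_setMat, Bigraph.setEdge]
  rw [h i j]
  have hab' : (a : ℕ) ≠ b := fun h => hab (Fin.ext h)
  rcases lt_trichotomy i j with hij | rfl | hij
  · have hij' : (i : ℕ) < j := hij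
    simp only [hij, if_true]
    have : ((i : ℕ) = min (a : ℕ) b ∧ (j : ℕ) = max (a : ℕ) b) ↔
        ((i = a ∧ j = b) ∨ (i = b ∧ j = a)) := by
      simp only [Fin.ext_iff]; omega
    simp only [this]
    split_ifs <;> rfl
  · have : ¬ ((i : ℕ) = min (a : ℕ) b ∧ (i : ℕ) = max (a : ℕ) b) := by omega
    simp [this]
  · have hij' : (j : ℕ) < i := hij
    have : ¬ ((i : ℕ) = min (a : ℕ) b ∧ (j : ℕ) = max (a : ℕ) b) := by omega
    simp [this, hij.not_gt, hij.ne']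

end Stores

/-! ## The Gram matrix -/

theorem lex_lt_iff {N i j k l : ℕ} (hj : j < N) (hl : l < N) :
    i * N + j < k * N + l ↔ i < k ∨ (i = k ∧ j < l) := by
  rcases lt_trichotomy i k with h | rfl | h
  · have : (i + 1) * N ≤ k * N := Nat.mul_le_mul_right _ h
    rw [add_mul, one_mul] at this
    constructor <;> intro <;> omega
  · omega
  · have : (k + 1) * N ≤ i * N := Nat.mul_le_mul_right _ h
    rw [add_mul, one_mul] at this
    constructor <;> intro <;> omega

theorem lex_lt_sq {N i j : ℕ} (hi : i < N) (hj : j < N) : i * N + j < N * N := by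
  have : (i + 1) * N ≤ N * N := Nat.mul_le_mul_right _ hi
  rw [add_mul, one_mul] at this
  omega

theorem runs_gramProg {n : ℕ} (hn : 1 ≤ n) {σ : State} {A : Matrix (Fin n) (Fin n) ℝ}
    (hσn : σ.reg .n = n) (hA : IsUnidiagonal A) (hA' : IsTriangleIntegral A)
    (hσ : ∀ i j : Fin n, σ.inp i j = A i j) :
    Runs gramProg σ (60 * n ^ 2) fun τ => Stores τ (Bigraph.ofMatrix A) := by
  refine Runs.mono (Runs.imp (Runs.forAll_pair (T := 32) (N := n)
    (fun k τ => ∀ i j : Fin n, (i : ℕ) * n + j < k →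
      τ.mat i j = if i < j then ((Bigraph.ofMatrix A).d i j : ℝ) else if i = j then 1 else 0)
    hσn hn rfl ?_ ?_ ?_) ?_) (by omega)
  · intro k τ x v h _; exact h
  · intro i j h; omega
  · intro k l τ hk hl hi hj hτn hf hI
    refine (Runs.basic rfl ?_).mono (by simp [Cmd.maxCost, BExpr.cost, RExpr.cost, NExpr.cost])
    intro i j hij
    have hin := hσ ⟨k, hk⟩ ⟨l, hl⟩
    have hin' := hσ ⟨l, hl⟩ ⟨k, hk⟩
    have hinkk := hσ ⟨k, hk⟩ ⟨k, hk⟩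
    simp only at hin hin' hinkk
    by_cases hlt : (i : ℕ) * n + j < k * n + l
    · have h1 : ¬ ((i : ℕ) = k ∧ (j : ℕ) = l) := by rintro ⟨rfl, rfl⟩; omega
      rw [← hI i j hlt]
      simp only [Cmd.run, BExpr.Holds, NExpr.eval, hi, hj]
      split_ifs with h2 h3
      · simp [h1]
      · subst h3; simp [h1]
      · simp [h1]
    · have heq : (i : ℕ) = k ∧ (j : ℕ) = l := by
        have h1 := (lex_lt_iff (i := i) (k := k) j.2 hl).not.1 hlt
        have h2 := (lex_lt_iff (i := k) (k := i) hl j.2).not.1 (by omega)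
        omega
      obtain ⟨rfl, rfl⟩ := heq
      simp only [Cmd.run, BExpr.Holds, NExpr.eval, RExpr.eval, hi, hj, hf.inp,
        Fin.eta] at hin hin' hinkk ⊢
      rcases lt_trichotomy i j with h | rfl | h
      · have h' : (i : ℕ) < j := h
        rw [if_pos h', if_pos h]
        simp only [State.mat_setMat, and_self, if_true, hin, hin', Bigraph.ofMatrix, h.ne, if_false]
        -- Integrality makes the floor in `ofMatrix` exact, so the real entry just written is the
        -- integer coefficient.
        obtain ⟨z, hz⟩ := hA' i j
        rw [triangularisation, if_pos h] at hz
        rw [hz, Int.floor_intCast]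
      · simp [hinkk, hA i]
      · have h' : (j : ℕ) < i := h
        simp [h.not_gt, h'.not_gt, h.ne', h'.ne']
  · intro τ _ h i j
    exact h i j (lex_lt_sq i.2 j.2)

/-! ## Counting and finding pairs -/

/-- On pairs of vertices, the test `t` (which depends on `i` and `j`) decides `P`. -/
def Tests (σ : State) (n : ℕ) (t : BExpr) (P : ℕ → Prop) : Prop :=
  ∀ (τ : State) (i j : ℕ), i < n → j < n → τ.mat = σ.mat → τ.arr = σ.arr → τ.reg .i = i →
    τ.reg .j = j → (t.Holds τ ↔ P (i * n + j))

theorem Tests.congr {σ τ : State} {n : ℕ} {t : BExpr} {P : ℕ → Prop} (h : Tests σ n t P)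
    (hm : τ.mat = σ.mat) (ha : τ.arr = σ.arr) : Tests τ n t P :=
  fun υ i j hi hj hm' ha' => h υ i j hi hj (hm'.trans hm) (ha'.trans ha)

variable {n : ℕ} {σ : State}

theorem Frame.arr_eq {p : Cmd} {σ τ : State} (h : Frame p σ τ) (hp : ∀ x, p.setsArr x = false) :
    τ.arr = σ.arr := funext fun x => h.arr x (hp x)

theorem runs_countPairs (hn : 1 ≤ n) (hσn : σ.reg .n = n) {t : BExpr} {P : ℕ → Prop}
    [DecidablePred P] (ht : Tests σ n t P) :
    Runs (countPairs t) σ (n ^ 2 * (t.cost + 36)) fun τ => τ.reg m = Nat.count P (n * n) := by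
  have h2 : 1 ≤ n ^ 2 := Nat.one_le_pow _ _ hn
  refine Runs.mono (T := 2 + n ^ 2 * ((t.cost + 1 + 5) + 28)) ?_ (by nlinarith)
  refine Runs.seq (Q' := fun τ => τ = σ.setReg m 0) (Runs.basic rfl rfl) ?_
  rintro _ - rfl
  refine Runs.forAll_pair (fun k τ => τ.reg m = Nat.count P k) (by simpa using hσn) hn rfl ?_ ?_ ?_
  · rintro k τ x v h (rfl | rfl) <;> simpa using h
  · simp
  · intro k l τ hk hl hi hj hτn hf hI
    have htτ := ht τ k l hk hl (hf.mat rfl) (hf.arr_eq fun _ => rfl) hi hj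
    refine (Runs.basic rfl ?_).mono (by simp [incr, Cmd.maxCost, NExpr.cost])
    rw [Nat.count_succ]
    by_cases h : P (k * n + l) <;> simp [Cmd.run, htτ, h, incr, NExpr.eval, hI]

/-- A passing pair is determined by how many passing pairs precede it. The claim about `a` and `b`
is guarded until the count exceeds k, and afterwards no later pair can overwrite them. -/
theorem runs_findPair (hn : 1 ≤ n) (hσn : σ.reg .n = n) {t : BExpr} {P : ℕ → Prop}
    [DecidablePred P] (ht : Tests σ n t P) (hk : σ.reg k < Nat.count P (n * n)) :
    Runs (findPair t) σ (n ^ 2 * (t.cost + 60)) fun τ =>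
      ∃ u v : Fin n, τ.reg a = u ∧ τ.reg b = v ∧ P (u * n + v) ∧
        Nat.count P (u * n + v) = σ.reg k := by
  have h2 : 1 ≤ n ^ 2 := Nat.one_le_pow _ _ hn
  refine Runs.mono (T := 2 + n ^ 2 * ((t.cost + 1 + 20) + 28)) ?_ (by nlinarith)
  refine Runs.seq (Q' := fun τ => τ = σ.setReg q 0) (Runs.basic rfl rfl) ?_
  rintro _ - rfl
  refine Runs.imp (Runs.forAll_pair (N := n) (fun l τ => τ.reg q = Nat.count P l ∧
    (σ.reg k < Nat.count P l → ∃ u v : Fin n, τ.reg a = u ∧ τ.reg b = v ∧ P (u * n + v) ∧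
        Nat.count P (u * n + v) = σ.reg k)) (by simpa using hσn) hn rfl ?_ ?_ ?_) ?_
  · rintro l τ x v h (rfl | rfl) <;> simpa using h
  · simp
  · intro i' j' τ hi' hj' hi hj hτn hf ⟨hI, hI'⟩
    have htτ := ht τ i' j' hi' hj' (hf.mat rfl) (hf.arr_eq fun _ => rfl) hi hj
    have hkτ : τ.reg k = σ.reg k := by rw [hf.reg k rfl]; simp
    refine (Runs.basic rfl ?_).mono (by simp [incr, Cmd.maxCost, NExpr.cost, BExpr.cost])
    rw [Nat.count_succ]
    by_cases h : P (i' * n + j')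
    · by_cases hq : Nat.count P (i' * n + j') = σ.reg k
      · simp only [Cmd.run, htτ, h, incr, NExpr.eval, hI, hkτ, BExpr.Holds, hq, if_true]
        refine ⟨by simp [hI, hq], fun _ => ⟨⟨i', hi'⟩, ⟨j', hj'⟩, by simp [hi], by simp [hj], h, hq⟩⟩
      · simp only [Cmd.run, htτ, h, incr, NExpr.eval, hI, hkτ, BExpr.Holds, hq, if_true, if_false]
        refine ⟨by simp, fun hlt => ?_⟩
        simpa using hI' (by omega)
    · simpa [Cmd.run, htτ, h, hI] using hI'
  · rintro τ - ⟨-, h⟩; exact h hk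

/-! ## Inflations -/

/-- After k passes exactly the edges from u to vertices below k have changed sign. -/
theorem runs_inflateVertexProg (hn : 1 ≤ n) (hσn : σ.reg .n = n) {D : Bigraph n}
    (hσ : Stores σ D) {x : Var} (hx : x ≠ c) {u : Fin n} (hu : σ.reg x = u) :
    Runs (inflateVertexProg x) σ (40 * n) fun τ => Stores τ (D.inflateVertex u) := by
  refine Runs.mono (Runs.imp (Runs.forAll (T := 26) (N := n) (fun k τ => ∃ E : Bigraph n,
    Stores τ E ∧ ∀ i j : Fin n, E.d i j =
      if (i = u ∧ (j : ℕ) < k) ∨ (j = u ∧ (i : ℕ) < k) then -D.d i j else D.d i j)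
    hσn hn rfl ?_ ?_) ?_) (by omega)
  · exact ⟨D, hσ, fun i j => by simp⟩
  · intro k hk τ hc hτn hf ⟨E, hE, hEd⟩
    have hxτ : τ.reg x = u := by
      rw [hf.reg, hu]
      simp [forAll, setEdge, Cmd.setsReg, hx]
    refine (Runs.basic rfl ?_).mono (by simp [setEdge, edge, Cmd.maxCost, NExpr.cost, BExpr.cost, RExpr.cost])
    -- The pass c = u writes nothing; the formulas for k and k + 1 differ there only at a diagonal
    -- zero.
    by_cases hku : k = u
    · refine ⟨E, ?_, fun i j => ?_⟩
      · refine hE.congr ?_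
        simp [Cmd.run, BExpr.Holds, NExpr.eval, hc, hxτ, hku]
      · rw [hEd]
        subst hku
        by_cases hi : i = u <;> by_cases hj : j = u
        · subst hi hj; simp [D.loopless]
        all_goals
          have hi' := (Fin.ext_iff (a := i) (b := u)).not
          have hj' := (Fin.ext_iff (a := j) (b := u)).not
          simp only [hi, hj, true_and, false_and, or_false, false_or]
          try (congr 1; simp only [eq_iff_iff]; omega)
    · have hne : u ≠ (⟨k, hk⟩ : Fin n) := fun h => hku (by rw [h])
      refine ⟨E.setEdge hne (-E.d u ⟨k, hk⟩), ?_, fun i j => ?_⟩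
      · simp only [Cmd.run, BExpr.Holds, NExpr.eval, hc, hxτ, hku, if_false]
        refine Stores.congr (hE.run_setEdge (e := x) (f := c) (u := .neg (edge x c))
          (a := u) (b := ⟨k, hk⟩) hxτ hc hne ?_) rfl
        simp only [RExpr.eval]
        rw [hE.eval_edge (e := x) (f := c) (a := u) (b := ⟨k, hk⟩) hxτ hc hne]
        simp
      · simp only [Bigraph.setEdge, hEd, Fin.ext_iff]
        by_cases h1 : ((i : ℕ) = u ∧ (j : ℕ) = k) ∨ ((i : ℕ) = k ∧ (j : ℕ) = u)
        · rw [if_pos h1, if_neg (by omega), if_pos (by omega)]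
          rcases h1 with ⟨h1, h2⟩ | ⟨h1, h2⟩
          · obtain rfl : i = u := Fin.ext h1
            obtain rfl : j = ⟨k, hk⟩ := Fin.ext h2
            rfl
          · obtain rfl : j = u := Fin.ext h2
            obtain rfl : i = ⟨k, hk⟩ := Fin.ext h1
            rw [D.symm]
        · rw [if_neg h1]
          congr 1
          simp only [eq_iff_iff]; omega
  · rintro τ - ⟨E, hE, hEd⟩
    have : E = D.inflateVertex u := by
      ext i j
      rw [hEd]
      simp [Bigraph.inflateVertex]
    exact this ▸ hE

/-- Working in place is safe: the update of d_vc reads d_uc and d_uv, which the loop never writes,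
and the sign of d_uv is changed only after the loop. -/
theorem runs_inflatePairProg (hn : 1 ≤ n) (hσn : σ.reg .n = n) {D : Bigraph n}
    (hσ : Stores σ D) {x y : Var} (hx : x ≠ c) (hy : y ≠ c) {u v : Fin n} (huv : u ≠ v)
    (hu : σ.reg x = u) (hv : σ.reg y = v) :
    Runs (inflatePairProg x y) σ (100 * n) fun τ => Stores τ (D.inflatePair u v) := by
  refine Runs.mono (T := n * (50 + 14) + 20) (Runs.seq (Runs.forAll (N := n)
    (fun k τ => ∃ E : Bigraph n,
    Stores τ E ∧ ∀ i j : Fin n, E.d i j =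
      if i = j then 0
      else if i = v ∧ j ≠ u ∧ (j : ℕ) < k then D.d v j - D.d u j * D.d u v
      else if j = v ∧ i ≠ u ∧ (i : ℕ) < k then D.d v i - D.d u i * D.d u v
      else D.d i j)
    hσn hn rfl ?_ ?_) ?_) (by omega)
  · refine ⟨D, hσ, fun i j => ?_⟩
    by_cases h : i = j
    · subst h; simp [D.loopless]
    · simp [h]
  · intro k hk τ hc hτn hf ⟨E, hE, hEd⟩
    have hxτ : τ.reg x = u := by
      rw [hf.reg, hu]
      simp [forAll, setEdge, Cmd.setsReg, hx]
    have hyτ : τ.reg y = v := by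
      rw [hf.reg, hv]
      simp [forAll, setEdge, Cmd.setsReg, hy]
    refine (Runs.basic rfl ?_).mono (by simp [setEdge, edge, Cmd.maxCost, NExpr.cost, BExpr.cost, RExpr.cost])
    by_cases hku : k = u ∨ k = v
    · refine ⟨E, ?_, fun i j => ?_⟩
      · refine hE.congr ?_
        simp [Cmd.run, BExpr.Holds, NExpr.eval, hc, hxτ, hyτ, hku]
      · have h0 : u.1 ≠ v.1 := fun h => huv (Fin.ext h)
        rw [hEd]
        simp only [Fin.ext_iff, ne_eq]
        by_cases hij : i.1 = j.1
        · simp [hij]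
        have e1 : (i.1 = v.1 ∧ ¬ j.1 = u.1 ∧ j.1 < k) ↔ (i.1 = v.1 ∧ ¬ j.1 = u.1 ∧ j.1 < k + 1) := by
          omega
        have e2 : (j.1 = v.1 ∧ ¬ i.1 = u.1 ∧ i.1 < k) ↔ (j.1 = v.1 ∧ ¬ i.1 = u.1 ∧ i.1 < k + 1) := by
          omega
        simp only [e1, e2]
    · have hku' : k ≠ u ∧ k ≠ v := by tauto
      have hne : v ≠ (⟨k, hk⟩ : Fin n) := fun h => hku'.2 (by rw [h])
      have hne' : u ≠ (⟨k, hk⟩ : Fin n) := fun h => hku'.1 (by rw [h])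
      refine ⟨E.setEdge hne (E.d v ⟨k, hk⟩ - E.d u ⟨k, hk⟩ * E.d u v), ?_, fun i j => ?_⟩
      · simp only [Cmd.run, BExpr.Holds, NExpr.eval, hc, hxτ, hyτ, hku, if_false]
        refine Stores.congr (hE.run_setEdge (e := y) (f := c)
          (u := .sub (edge y c) (.mul (edge x c) (edge x y)))
          (a := v) (b := ⟨k, hk⟩) hyτ hc hne ?_) rfl
        simp only [RExpr.eval]
        rw [hE.eval_edge (e := y) (f := c) (a := v) (b := ⟨k, hk⟩) hyτ hc hne,
          hE.eval_edge (e := x) (f := c) (a := u) (b := ⟨k, hk⟩) hxτ hc hne',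
          hE.eval_edge (e := x) (f := y) (a := u) (b := v) hxτ hyτ huv]
        push_cast; rfl
      · have h0 : u.1 ≠ v.1 := fun h => huv (Fin.ext h)
        -- The three coefficients read in this pass still have their original values.
        have hvk : E.d v ⟨k, hk⟩ = D.d v ⟨k, hk⟩ := by
          rw [hEd, if_neg hne, if_neg (by simp), if_neg (by simp [hne.symm])]
        have huk : E.d u ⟨k, hk⟩ = D.d u ⟨k, hk⟩ := by
          rw [hEd, if_neg hne', if_neg (by simp), if_neg (by simp)]
        have huv' : E.d u v = D.d u v := by
          rw [hEd, if_neg huv, if_neg (by simp [huv]), if_neg (by simp)]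
        rw [hvk, huk, huv']
        simp only [Bigraph.setEdge]
        by_cases h1 : (i = v ∧ j = ⟨k, hk⟩) ∨ (i = ⟨k, hk⟩ ∧ j = v)
        · rw [if_pos h1]
          rcases h1 with ⟨rfl, rfl⟩ | ⟨rfl, rfl⟩
          · simp [hne, hne'.symm]
          · simp [hne.symm, hne'.symm]
        · rw [if_neg h1, hEd]
          simp only [Fin.ext_iff, ne_eq] at h1 ⊢
          by_cases hij : i.1 = j.1
          · simp [hij]
          have e1 : (i.1 = v.1 ∧ ¬ j.1 = u.1 ∧ j.1 < k) ↔
              (i.1 = v.1 ∧ ¬ j.1 = u.1 ∧ j.1 < k + 1) := by omega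
          have e2 : (j.1 = v.1 ∧ ¬ i.1 = u.1 ∧ i.1 < k) ↔
              (j.1 = v.1 ∧ ¬ i.1 = u.1 ∧ i.1 < k + 1) := by omega
          simp only [e1, e2]
  · rintro τ hf ⟨E, hE, hEd⟩
    have hxτ : τ.reg x = u := by
      rw [hf.reg, hu]
      simp [forAll, setEdge, Cmd.setsReg, hx]
    have hyτ : τ.reg y = v := by
      rw [hf.reg, hv]
      simp [forAll, setEdge, Cmd.setsReg, hy]
    refine (Runs.basic rfl ?_).mono (by simp [setEdge, edge, Cmd.maxCost, NExpr.cost, RExpr.cost])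
    have : E.setEdge huv (-E.d u v) = D.inflatePair u v := by
      ext i j
      have huv' : E.d u v = D.d u v := by
        rw [hEd, if_neg huv, if_neg (by simp [huv]), if_neg (by simp)]
      simp only [Bigraph.setEdge, Bigraph.inflatePair, huv']
      by_cases hij : i = j
      · subst hij
        rw [if_neg (by rintro (⟨rfl, h⟩ | ⟨rfl, h⟩) <;> simp_all), hEd, if_pos rfl, if_pos rfl]
      · by_cases h1 : (i = u ∧ j = v) ∨ (i = v ∧ j = u)
        · rw [if_pos h1, if_neg hij, if_pos h1]
        · rw [if_neg h1, if_neg hij, if_neg h1, hEd, if_neg hij]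
          simp only [Fin.is_lt, and_true]
          by_cases hi : i = v
          · have : j ≠ u := fun h => h1 (.inr ⟨hi, h⟩)
            simp [hi, this]
          · by_cases hj : j = v
            · have : i ≠ u := fun h => h1 (.inl ⟨h, hj⟩)
              simp [hi, hj, this]
            · simp [hi, hj]
    rw [← this]
    refine hE.run_setEdge (e := x) (f := y) hxτ hyτ huv ?_
    simp only [RExpr.eval]
    rw [hE.eval_edge (e := x) (f := y) hxτ hyτ huv]
    simp

end Machine

namespace Machine

open Var Arr

variable {n : ℕ} {σ : State}

/-! ## Selection of pairs -/

/-- The numbers `u * n + v` of the pairs that are related by `R`. -/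
def PairNumber (R : Fin n → Fin n → Prop) (l : ℕ) : Prop :=
  ∃ u v : Fin n, l = u * n + v ∧ R u v

theorem pairNumber_iff {R : Fin n → Fin n → Prop} (u v : Fin n) :
    PairNumber R (u * n + v) ↔ R u v := by
  refine ⟨?_, fun h => ⟨u, v, rfl, h⟩⟩
  rintro ⟨u', v', h, hR⟩
  have h1 := (lex_lt_iff (i := (u : ℕ)) (k := u') v.2 v'.2).not.1 (by omega)
  have h2 := (lex_lt_iff (i := (u' : ℕ)) (k := u) v'.2 v.2).not.1 (by omega)
  obtain rfl : u = u' := Fin.ext (by omega)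
  obtain rfl : v = v' := Fin.ext (by omega)
  exact hR

theorem toLex_le_iff (u v u' v' : Fin n) :
    toLex (u, v) ≤ toLex (u', v') ↔ (u : ℕ) * n + v ≤ u' * n + v' := by
  rw [← not_lt, ← not_lt, not_iff_not, Prod.Lex.toLex_lt_toLex, lex_lt_iff v'.2 v.2]
  simp only [Fin.lt_def, Fin.ext_iff]

open Classical in
theorem pairNumber_count_pos {R : Fin n → Fin n → Prop} :
    0 < Nat.count (PairNumber R) (n * n) ↔ ∃ u v, R u v := by
  constructor
  · intro h
    obtain ⟨l, -, u, v, -, hR⟩ := Nat.count_ne_iff_exists.1 h.ne'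
    exact ⟨u, v, hR⟩
  · rintro ⟨u, v, h⟩
    have h1 : Nat.count (PairNumber R) (u * n + v) < Nat.count (PairNumber R) (n * n) :=
      Nat.count_strict_mono ((pairNumber_iff u v).2 h) (lex_lt_sq u.2 v.2)
    omega

/-- `u < v` are joined by dotted edges. -/
def DottedPair (D : Bigraph n) (u v : Fin n) : Prop := u < v ∧ D.Dotted u v

theorem Stores.tests_dotted {D : Bigraph n} (h : Stores σ D) :
    Tests σ n dottedTest (PairNumber (DottedPair D)) := by
  intro τ i' j' hi' hj' hm _ hi hj
  have := pairNumber_iff (R := DottedPair D) ⟨i', hi'⟩ ⟨j', hj'⟩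
  rw [this]
  simp only [dottedTest, BExpr.Holds, NExpr.eval, RExpr.eval, hi, hj, hm, DottedPair, Fin.mk_lt_mk]
  refine and_congr_right fun hlt => ?_
  have := h.mat_lt (i := ⟨i', hi'⟩) (j := ⟨j', hj'⟩) hlt
  simp only at this
  rw [this, Int.cast_lt, Bigraph.Dotted]

/-- The numbers of the pairs that the strategy `s` can select out of `m` pairs. -/
def Admissible (s : Fin 4) (m k : ℕ) : Prop :=
  (s = 0 → k = 0) ∧ (s = 1 → k = m - 1) ∧ (s = 2 → k = 0 ∨ k = m - 1) ∧ k < m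

open Classical in
-- If no dotted pair is counted before (u, v), it is the first. If all but one are, it is the last:
-- a later dotted pair would force two strict increases of the count between (u, v) and the end.
theorem selects_of_admissible {D : Bigraph n} {s : Fin 4} {k : ℕ} {u v : Fin n}
    (hk : Admissible s (Nat.count (PairNumber (DottedPair D)) (n * n)) k)
    (huv : DottedPair D u v) (hc : Nat.count (PairNumber (DottedPair D)) (u * n + v) = k) :
    D.Selects s u v := by
  have hfirst : k = 0 → D.IsFirstDotted u v := by
    rintro rfl
    refine ⟨huv, fun u' v' h1 h2 => (toLex_le_iff _ _ _ _).2 ?_⟩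
    by_contra! hlt
    exact Nat.count_iff_forall_not.1 hc _ hlt ((pairNumber_iff (R := DottedPair D) u' v').2 ⟨h1, h2⟩)
  have hlast : k = Nat.count (PairNumber (DottedPair D)) (n * n) - 1 → D.IsLastDotted u v := by
    intro hk'
    refine ⟨huv, fun u' v' h1 h2 => (toLex_le_iff _ _ _ _).2 ?_⟩
    by_contra! hlt
    have h3 := Nat.count_strict_mono ((pairNumber_iff (R := DottedPair D) u v).2 huv) hlt
    have h4 := Nat.count_strict_mono ((pairNumber_iff (R := DottedPair D) u' v').2 ⟨h1, h2⟩) (lex_lt_sq u'.2 v'.2)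
    omega
  obtain ⟨h0, h1, h2, -⟩ := hk
  fin_cases s
  · exact hfirst (h0 rfl)
  · exact hlast (h1 rfl)
  · exact (h2 rfl).imp hfirst hlast
  · exact huv

open Classical in
-- Choosing a rank takes constant time, and every outcome of a draw is admissible; the time is spent
-- in the scan for the pair of that rank.
theorem runs_selectProg (hn : 1 ≤ n) (hσn : σ.reg .n = n) {D : Bigraph n} (hσ : Stores σ D)
    {s : Fin 4} (hs : σ.reg strategy = s)
    (hm : σ.reg m = Nat.count (PairNumber (DottedPair D)) (n * n)) (hpos : 0 < σ.reg m) :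
    Runs selectProg σ (120 * n ^ 2) fun τ =>
      ∃ u v : Fin n, τ.reg a = u ∧ τ.reg b = v ∧ D.Selects s u v := by
  have h2 : 1 ≤ n ^ 2 := Nat.one_le_pow _ _ hn
  refine Runs.mono (T := 45 + n ^ 2 * (9 + 60)) ?_ (by nlinarith)
  refine Runs.seq (Q' := fun τ => Admissible s (σ.reg m) (τ.reg k)) ?_ ?_
  · have hs' : (σ.reg strategy = 0 ↔ s = 0) ∧ (σ.reg strategy = 1 ↔ s = 1) ∧
        (σ.reg strategy = 2 ↔ s = 2) := by
      rw [hs]; refine ⟨?_, ?_, ?_⟩ <;> rw [Fin.ext_iff] <;> rfl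
    refine Runs.mono (Runs.ite (T := 30) ?_ ?_) (by simp [BExpr.cost, NExpr.cost])
    · intro h
      replace h := hs'.1.1 h
      subst h
      exact (Runs.basic rfl (by simpa [Admissible, Cmd.run, NExpr.eval] using hpos)).mono
        (by simp [Cmd.maxCost, NExpr.cost])
    intro h0
    replace h0 := hs'.1.not.1 h0
    refine Runs.mono (Runs.ite (T := 24) ?_ ?_) (by simp [BExpr.cost, NExpr.cost])
    · intro h
      replace h := hs'.2.1.1 h
      subst h
      exact (Runs.basic rfl (by simpa [Admissible, Cmd.run, NExpr.eval] using hpos)).mono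
        (by simp [Cmd.maxCost, NExpr.cost])
    intro h1
    replace h1 := hs'.2.1.not.1 h1
    refine Runs.mono (Runs.ite (T := 18) ?_ ?_) (by simp [BExpr.cost, NExpr.cost])
    · intro h
      replace h := hs'.2.2.1 h
      subst h
      refine Runs.mono (Runs.seq (Q' := fun _ => True)
        (Runs.choose (e := 2) Nat.two_pos fun _ _ => trivial) fun τ hf _ => ?_)
        (T := 2 + 12) (by omega)
      have hmτ : τ.reg m = σ.reg m := hf.reg m rfl
      refine (Runs.basic rfl ?_).mono (by simp [Cmd.maxCost, NExpr.cost, BExpr.cost])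
      by_cases hc : τ.reg c = 0
      · simpa [Admissible, Cmd.run, BExpr.Holds, NExpr.eval, hc] using hpos
      · simpa [Admissible, Cmd.run, BExpr.Holds, NExpr.eval, hc, hmτ] using hpos
    intro h2
    replace h2 := hs'.2.2.not.1 h2
    exact (Runs.choose (e := m) hpos fun τ hτ => by simpa [Admissible, h0, h1, h2, NExpr.eval] using hτ).mono
      (by simp [NExpr.cost])
  · intro τ hf hk
    have hmat : τ.mat = σ.mat := hf.mat rfl
    rw [hm] at hk
    refine (runs_findPair hn ((hf.reg _ rfl).trans hσn) (hσ.congr hmat).tests_dotted hk.2.2.2).imp ?_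
    rintro υ - ⟨u, v, hu, hv, hP, hc⟩
    exact ⟨u, v, hu, hv, selects_of_admissible hk ((pairNumber_iff u v).1 hP) hc⟩

/-! ## The two loops -/

open Classical in
-- A pass consists of two scans and one O(n) inflation, and the inflation counter limits the passes.
theorem runs_inflationsAtPairProg (hn : 1 ≤ n) (hσn : σ.reg .n = n) {D : Bigraph n}
    (hσ : Stores σ D) {s : Fin 4} (hs : σ.reg strategy = s) :
    Runs inflationsAtPairProg σ ((σ.reg limit + 1) * (300 * n ^ 2)) fun τ =>
      ∃ D', Stores τ D' ∧ Bigraph.InflationsAtPair s (σ.reg limit) D D' := by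
  have h1 : n ≤ n ^ 2 := by nlinarith
  refine Runs.mono (T := 2 + (n ^ 2 * (9 + 36) + (σ.reg limit * (7 + 1 + 269 * n ^ 2) + (7 + 1))))
    ?_ (by nlinarith)
  refine Runs.seq (Q' := fun τ => τ = σ.setReg count 0) (Runs.basic rfl rfl) ?_
  rintro _ - rfl
  refine Runs.seq (runs_countPairs hn (by simpa using hσn)
    (Stores.tests_dotted (D := D) (hσ.congr rfl))) ?_
  intro τ hf hm
  -- The rank r is the remaining budget. The last clause is in continuation form: any run from the
  -- current bigraph with budget r completes to a run from `D` with the whole budget.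
  refine Runs.loop (c := .and (.lt 0 m) (.lt count limit)) (I := fun r τ => ∃ E : Bigraph n,
    τ.reg .n = n ∧ τ.reg strategy = s ∧ τ.reg limit = σ.reg limit ∧ τ.reg count + r = σ.reg limit ∧
    τ.reg m = Nat.count (PairNumber (DottedPair E)) (n * n) ∧ Stores τ E ∧
    ∀ D', Bigraph.InflationsAtPair s r E D' → Bigraph.InflationsAtPair s (σ.reg limit) D D')
    (σ.reg limit) ?_ ?_ ?_
  · rintro r τ ⟨E, hn', hs', hl, hr, hm, hE, hD⟩ hc
    simp only [BExpr.Holds, NExpr.eval] at hc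
    obtain ⟨r, rfl⟩ : ∃ r', r = r' + 1 := ⟨r - 1, by omega⟩
    refine ⟨r, by omega, Runs.mono (T := 120 * n ^ 2 + (100 * n + (4 + n ^ 2 * (9 + 36)))) ?_
      (by nlinarith)⟩
    refine Runs.seq (runs_selectProg hn hn' hE hs' hm hc.1) ?_
    rintro τ₁ hf₁ ⟨u, v, hu, hv, hsel⟩
    have huv : DottedPair E u v := by
      fin_cases s
      · exact hsel.1
      · exact hsel.1
      · exact hsel.elim And.left And.left
      · exact hsel
    refine Runs.seq (runs_inflatePairProg hn ((hf₁.reg _ rfl).trans hn') (hE.congr (hf₁.mat rfl))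
      (by decide) (by decide) huv.1.ne hu hv) ?_
    intro τ₂ hf₂ hE₂
    refine Runs.seq (Q' := fun υ => υ = τ₂.setReg count (τ₂.reg count + 1)) (Runs.basic rfl rfl) ?_
    rintro _ - rfl
    have hn₂ : (τ₂.setReg count (τ₂.reg count + 1)).reg .n = n := by
      simp [hf₂.reg .n rfl, hf₁.reg .n rfl, hn']
    refine (runs_countPairs hn hn₂
      (Stores.tests_dotted (D := E.inflatePair u v) (hE₂.congr rfl))).imp ?_
    intro τ₃ hf₃ hm₃
    refine ⟨_, ?_, ?_, ?_, ?_, hm₃, hE₂.congr (hf₃.mat rfl), fun D' hD' => hD D' ?_⟩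
    · simp [hf₃.reg .n rfl, hf₂.reg .n rfl, hf₁.reg .n rfl, hn']
    · simp [hf₃.reg strategy rfl, hf₂.reg strategy rfl, hf₁.reg strategy rfl, hs']
    · simp [hf₃.reg limit rfl, hf₂.reg limit rfl, hf₁.reg limit rfl, hl]
    · simp [hf₃.reg count rfl, hf₂.reg count rfl, hf₁.reg count rfl]
      omega
    · exact .step r _ _ u v hsel hD'
  · rintro r τ ⟨E, hn', hs', hl, hr, hm, hE, hD⟩ hc
    simp only [BExpr.Holds, NExpr.eval] at hc
    refine ⟨E, hE, hD E ?_⟩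
    -- If dotted edges remain, the limit stopped the loop; otherwise there are none. The count
    -- ranges over u < v only, so the second case also needs symmetry.
    by_cases h0 : 0 < τ.reg m
    · obtain rfl : r = 0 := by
        have : ¬ τ.reg count < τ.reg limit := fun h => hc ⟨h0, h⟩
        omega
      exact .broken E
    · rw [hm, pairNumber_count_pos] at h0
      refine .done r E fun u v huv => h0 ?_
      rcases lt_trichotomy u v with h | rfl | h
      · exact ⟨u, v, h, huv⟩
      · simp [Bigraph.Dotted, E.loopless] at huv
      · exact ⟨v, u, h, by rwa [Bigraph.Dotted, E.symm]⟩
  · refine ⟨D, ?_, ?_, ?_, ?_, hm, hσ.congr (hf.mat rfl), fun _ h => h⟩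
    · simp [hf.reg .n rfl, hσn]
    · simp [hf.reg strategy rfl, hs]
    · simp [hf.reg limit rfl]
    · simp [hf.reg count rfl]

/-- The pairs that lead out of `S` along an edge. -/
def CrossingPair (D : Bigraph n) (S : Finset (Fin n)) (u v : Fin n) : Prop :=
  u ∈ S ∧ v ∉ S ∧ D.d u v ≠ 0

theorem Stores.tests_crossing {D : Bigraph n} (h : Stores σ D) {S : Finset (Fin n)}
    (hS : ∀ v : Fin n, σ.arr inS v = if v ∈ S then 1 else 0) :
    Tests σ n crossingTest (PairNumber (CrossingPair D S)) := by
  intro τ i' j' hi' hj' hm ha hi hj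
  have := pairNumber_iff (R := CrossingPair D S) ⟨i', hi'⟩ ⟨j', hj'⟩
  rw [this]
  have h1 := hS ⟨i', hi'⟩
  have h2 := hS ⟨j', hj'⟩
  simp only at h1 h2
  simp only [crossingTest, BExpr.Holds, CrossingPair, ← and_assoc]
  have h3 : (NExpr.eval τ (.arr inS i) = NExpr.eval τ 1 ∧ NExpr.eval τ (.arr inS j) = NExpr.eval τ 0)
      ↔ (⟨i', hi'⟩ : Fin n) ∈ S ∧ (⟨j', hj'⟩ : Fin n) ∉ S := by
    change (τ.arr inS (τ.reg .i) = 1 ∧ τ.arr inS (τ.reg .j) = 0) ↔ _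
    rw [ha, hi, hj, h1, h2]
    simp
  rw [h3]
  refine and_congr_right fun hmem => ?_
  have hne : (⟨i', hi'⟩ : Fin n) ≠ ⟨j', hj'⟩ := fun h => hmem.2 (h ▸ hmem.1)
  rw [(h.congr hm).eval_edge (e := i) (f := j) (a := ⟨i', hi'⟩) (b := ⟨j', hj'⟩) hi hj hne]
  simp [RExpr.eval]

open Classical in
-- The rank is n minus the size of S, initially n - 1, and a pass costs two scans plus O(n).
-- Connectedness is part of the invariant because it provides the crossing edge for the next choice.
theorem runs_rootProg [NeZero n] (hσn : σ.reg .n = n) {D : Bigraph n} (hσ : Stores σ D)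
    (hD : D.Connected) :
    Runs rootProg σ (500 * n ^ 3) fun τ =>
      ∃ D', Stores τ D' ∧ D.InflationsToPosSincereRoot D' := by
  have hn : 1 ≤ n := NeZero.one_le
  have h1 : n ≤ n ^ 2 := by nlinarith
  have h2 : n ^ 2 ≤ n ^ 3 := Nat.pow_le_pow_right hn (by omega)
  refine Runs.mono (T := n * (3 + 14) + (3 + (2 + (n * (3 + 1 + 380 * n ^ 2) + (3 + 1)))))
    ?_ (by nlinarith)
  refine Runs.seq (Runs.forAll (N := n) (fun k τ => ∀ i < k, τ.arr inS i = 0) hσn hn rfl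
    (by simp) ?_) ?_
  · intro k hk τ hi hτn hf hI
    refine (Runs.basic rfl ?_).mono (by simp [Cmd.maxCost, NExpr.cost])
    intro l hl
    simp only [Cmd.run, NExpr.eval, hi, State.arr_setReg, State.arr_setArr, true_and]
    split_ifs with h
    · rfl
    · exact hI l (by omega)
  intro τ hf hS
  refine Runs.seq (Q' := fun υ => υ = τ.setArr inS 0 1) (Runs.basic rfl rfl) ?_
  rintro _ - rfl
  refine Runs.seq (Q' := fun υ => υ = (τ.setArr inS 0 1).setReg size 1) (Runs.basic rfl rfl) ?_
  rintro _ - rfl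
  refine Runs.loop (c := .lt size Var.n) (I := fun r τ => ∃ (E : Bigraph n) (S : Finset (Fin n)),
    τ.reg .n = n ∧ τ.reg size = S.card ∧ S.card + r = n ∧ S.Nonempty ∧
    (∀ v : Fin n, τ.arr inS v = if v ∈ S then 1 else 0) ∧ E.Connected ∧ Stores τ E ∧
    ∀ D', Bigraph.RootLoop S E D' → Bigraph.RootLoop {0} D D') (n - 1) (T := 380 * n ^ 2) ?_ ?_ ?_ |>.mono ?_
  · rintro r τ ⟨E, S, hn', hsize, hr, hne, hS, hEc, hE, hD⟩ hc
    simp only [BExpr.Holds, NExpr.eval, hn', hsize] at hc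
    refine ⟨r - 1, by omega, Runs.mono (T := n ^ 2 * (20 + 36) + (2 + (n ^ 2 * (20 + 60) +
      ((9 + 1 + 40 * n) + (100 * n + (3 + 4)))))) ?_ (by nlinarith)⟩
    refine Runs.seq (runs_countPairs hn hn' (hE.tests_crossing hS)) ?_
    intro τ₁ hf₁ hm₁
    have hpos : 0 < τ₁.reg m := by
      rw [hm₁, pairNumber_count_pos]
      obtain ⟨u, hu, v, hv, huv⟩ := hEc.exists_crossing hne hc
      exact ⟨u, v, hu, hv, huv⟩
    refine Runs.seq (Q' := fun υ => υ.reg k < τ₁.reg m) (Runs.choose (e := m) hpos fun υ h => h) ?_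
    intro τ₂ hf₂ hk₂
    have hn₂ : τ₂.reg .n = n := by rw [hf₂.reg _ rfl, hf₁.reg _ rfl, hn']
    have hE₂ : Stores τ₂ E := (hE.congr (hf₁.mat rfl)).congr (hf₂.mat rfl)
    have ha₂ : τ₂.arr = τ.arr := (hf₂.arr_eq fun _ => rfl).trans (hf₁.arr_eq fun _ => rfl)
    have hS₂ : ∀ v : Fin n, τ₂.arr inS v = if v ∈ S then 1 else 0 := by rw [ha₂]; exact hS
    refine Runs.seq (runs_findPair hn hn₂ (hE₂.tests_crossing hS₂) (hm₁ ▸ hk₂)) ?_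
    rintro τ₃ hf₃ ⟨u, v, hu, hv, hP, -⟩
    obtain ⟨huS, hvS, huv⟩ := (pairNumber_iff u v).1 hP
    have hne' : u ≠ v := by rintro rfl; exact hvS huS
    have hn₃ : τ₃.reg .n = n := by rw [hf₃.reg _ rfl, hn₂]
    have hE₃ : Stores τ₃ E := hE₂.congr (hf₃.mat rfl)
    have hdot : BExpr.Holds τ₃ (.rlt (.lit 0) (edge a b)) ↔ E.Dotted u v := by
      simp only [BExpr.Holds]
      rw [hE₃.eval_edge (e := a) (f := b) hu hv hne']
      simp only [RExpr.eval, Int.cast_lt, Bigraph.Dotted]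
    let F := if E.Dotted u v then E else E.inflateVertex v
    refine Runs.seq (Q' := fun υ => Stores υ F) (Runs.ite (T := 40 * n) ?_ ?_) ?_
    · intro h
      refine (Runs.basic rfl ?_).mono (by simp [Cmd.maxCost]; omega)
      simpa [F, hdot.1 h, Cmd.run] using hE₃
    · intro h
      simpa [F, hdot.not.1 h] using runs_inflateVertexProg hn hn₃ hE₃ (by decide) hv
    intro τ₄ hf₄ hF
    refine Runs.seq (runs_inflatePairProg hn ((hf₄.reg _ rfl).trans hn₃) hF (by decide) (by decide)
      hne'.symm ((hf₄.reg _ rfl).trans hv) ((hf₄.reg _ rfl).trans hu)) ?_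
    intro τ₅ hf₅ hF₅
    have hb₅ : τ₅.reg b = v := by rw [hf₅.reg _ rfl, hf₄.reg _ rfl, hv]
    have hs₅ : τ₅.reg size = S.card := by
      rw [hf₅.reg _ rfl, hf₄.reg _ rfl, hf₃.reg _ rfl, hf₂.reg _ rfl, hf₁.reg _ rfl, hsize]
    have ha₅ : τ₅.arr = τ.arr := by
      rw [hf₅.arr_eq fun _ => rfl, hf₄.arr_eq fun _ => rfl, hf₃.arr_eq fun _ => rfl, ha₂]
    have hn₅ : τ₅.reg .n = n := by rw [hf₅.reg _ rfl, hf₄.reg _ rfl, hn₃]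
    refine (Runs.basic (p := .store inS b 1 ;; incr size) rfl ?_).mono
      (by simp [incr, Cmd.maxCost, NExpr.cost])
    have hcard : (insert v S).card = S.card + 1 := Finset.card_insert_of_notMem hvS
    refine ⟨F.inflatePair v u, insert v S, ?_, ?_, by omega, by simp, fun w => ?_, ?_,
      hF₅.congr rfl, fun D' hD' => hD D' ?_⟩
    · simp [Cmd.run, incr, hn₅]
    · simp [Cmd.run, incr, hcard, NExpr.eval, hs₅]
    · simp only [Cmd.run, incr, State.arr_setReg, State.arr_setArr, NExpr.eval, hb₅, ha₅, hS,
        true_and, Finset.mem_insert, Fin.ext_iff]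
      by_cases hw : w.1 = v.1 <;> simp [hw]
    -- The optional vertex inflation changes signs only, so the chosen edge is still present and the
    -- pair inflation preserves connectedness.
    · have hFuv : F.d v u ≠ 0 := by
        rw [F.symm]
        simp only [F]
        split_ifs
        · exact huv
        · simpa [Bigraph.inflateVertex, hne'] using huv
      refine Bigraph.Connected.inflatePair ?_ hFuv
      simp only [F]
      split_ifs
      · exact hEc
      · exact hEc.inflateVertex v
    · exact .step S E D' u v hc huS hvS huv hD'
  · rintro r τ ⟨E, S, hn', hsize, hr, hne, hS, hEc, hE, hD⟩ hc
    simp only [BExpr.Holds, NExpr.eval, hn', hsize] at hc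
    exact ⟨E, hE, hD E (.done S E (by omega))⟩
  · refine ⟨D, {0}, ?_, by simp, by simp; omega, by simp, fun v => ?_, hD, ?_, fun _ h => h⟩
    · simp [hf.reg .n rfl, hσn]
    · simp only [State.arr_setReg, State.arr_setArr, hS v v.2, Finset.mem_singleton, true_and,
        ← Fin.val_eq_zero_iff]
    · exact hσ.congr (hf.mat rfl)
  · exact Nat.add_le_add (Nat.mul_le_mul_right _ (Nat.sub_le _ _)) le_rfl

end Machine

/-! ## Recognition of Dynkin graphs -/

theorem branchedPath_adj {n k : ℕ} (i j : Fin n) : (branchedPath n k).Adj i j ↔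
    (i : ℕ) ≠ j ∧ ((((i : ℕ) + 1 = j ∧ (j : ℕ) + 1 < n) ∨ ((i : ℕ) = k ∧ (j : ℕ) + 1 = n)) ∨
      (((j : ℕ) + 1 = i ∧ (i : ℕ) + 1 < n) ∨ ((j : ℕ) = k ∧ (i : ℕ) + 1 = n))) := by
  simp [branchedPath, SimpleGraph.fromRel_adj, Fin.ext_iff]

/-- Attaching the extra vertex at the end of the path merely prolongs it. Thus 𝔸ₙ is a branched path
as well, and one comparison procedure serves all types. -/
theorem branchedPath_eq_pathGraph (n : ℕ) : branchedPath n (n - 2) = SimpleGraph.pathGraph n := by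
  ext i j
  rw [branchedPath_adj, SimpleGraph.pathGraph_adj]
  omega

/-- The positions of the branching of the Dynkin graphs, drawn as branched paths. -/
def IsDynkinBranching (n k : ℕ) : Prop :=
  k = n - 2 ∨ (3 < n ∧ k = 1) ∨ ((5 < n ∧ n < 9) ∧ k = 2)

namespace Bigraph

variable {n : ℕ}

theorem isDynkin_iff (D : Bigraph n) (hn : 1 ≤ n) : D.IsDynkin ↔
    (∀ a b, D.d a b = 0 ∨ D.d a b = -1) ∧
      ∃ k, IsDynkinBranching n k ∧ Nonempty (D.underlying ≃g branchedPath n k) := by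
  refine and_congr_right fun _ => ?_
  rw [← branchedPath_eq_pathGraph]
  constructor
  · rintro (⟨-, h⟩ | ⟨h', h⟩ | ⟨h', h'', h⟩)
    · exact ⟨_, .inl rfl, h⟩
    · exact ⟨_, .inr (.inl ⟨h', rfl⟩), h⟩
    · exact ⟨_, .inr (.inr ⟨⟨h', by omega⟩, rfl⟩), h⟩
  · rintro ⟨k, rfl | ⟨h', rfl⟩ | ⟨h', rfl⟩, h⟩
    · exact .inl ⟨hn, h⟩
    · exact .inr (.inl ⟨h', h⟩)
    · exact .inr (.inr ⟨h'.1, by omega, h⟩)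

/-- The number of the vertices that are joined to `v`. -/
def deg (D : Bigraph n) (v : Fin n) : ℕ := (Finset.univ.filter fun w => D.d v w ≠ 0).card

/-- The degree of `v` if it is joined to `u`, and `0` otherwise. -/
def score (D : Bigraph n) (u v : Fin n) : ℕ := if D.d u v = 0 then 0 else D.deg v

theorem deg_lt_two {D : Bigraph n} {v : Fin n}
    (h : ∀ w w', D.d v w ≠ 0 → D.d v w' ≠ 0 → w = w') : D.deg v < 2 := by
  have : D.deg v ≤ 1 := Finset.card_le_one.2 fun w hw w' hw' =>
    h w w' (by simpa using hw) (by simpa using hw')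
  omega

theorem two_le_deg {D : Bigraph n} {v w w' : Fin n} (hw : D.d v w ≠ 0) (hw' : D.d v w' ≠ 0)
    (h : w ≠ w') : 2 ≤ D.deg v :=
  Finset.one_lt_card.2 ⟨w, by simpa using hw, w', by simpa using hw', h⟩

theorem score_pos {D : Bigraph n} {u v : Fin n} (h : D.d u v ≠ 0) : 0 < D.score u v := by
  rw [score, if_neg h]
  exact Finset.card_pos.2 ⟨u, by simpa [D.symm v u] using h⟩

theorem adj_of_score_pos {D : Bigraph n} {u v : Fin n} (h : 0 < D.score u v) : D.d u v ≠ 0 := by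
  intro h0; simp [score, h0] at h

/-- In the list `L` of all vertices, each next vertex has the largest possible score with respect
to the preceding one. -/
structure GreedyList (D : Bigraph n) (L : Fin n → Fin n) : Prop where
  injective : Function.Injective L
  score_le : ∀ p q : Fin n, (p : ℕ) + 1 = q → ∀ v, (∀ r < q, L r ≠ v) →
    D.score (L p) v ≤ D.score (L p) (L q)

/-- The list `L` identifies `D` with the branched path. -/
def Matches (D : Bigraph n) (L : Fin n → Fin n) (k : ℕ) : Prop :=
  ∀ i j : Fin n, i < j → D.d (L i) (L j) =
    if ((j : ℕ) = i + 1 ∧ (j : ℕ) + 1 < n) ∨ ((j : ℕ) + 1 = n ∧ (i : ℕ) = k) then -1 else 0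

/-- Soundness of the recognition: an injective list of n vertices is a bijection, and the comparison
says that it carries edges to edges. Greediness plays no role here. -/
theorem Matches.isDynkin {D : Bigraph n} {L : Fin n → Fin n} {k : ℕ} (h : D.Matches L k)
    (hn : 1 ≤ n) (hL : Function.Injective L) (hk : IsDynkinBranching n k) : D.IsDynkin := by
  have hb : Function.Bijective L := Finite.injective_iff_bijective.1 hL
  refine (D.isDynkin_iff hn).2 ⟨fun a b => ?_, k, hk, ⟨RelIso.symm ⟨Equiv.ofBijective L hb, ?_⟩⟩⟩
  · obtain ⟨i, rfl⟩ := hb.2 a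
    obtain ⟨j, rfl⟩ := hb.2 b
    rcases lt_trichotomy i j with hij | rfl | hij
    · rw [h i j hij]; split_ifs <;> simp
    · exact .inl (D.loopless _)
    · rw [D.symm, h j i hij]; split_ifs <;> simp
  · intro i j
    rw [branchedPath_adj]
    change D.d (L i) (L j) ≠ 0 ↔ _
    rcases lt_trichotomy i j with hij | rfl | hij
    · have hij' : (i : ℕ) < j := hij
      rw [h i j hij, ite_ne_right_iff]
      simp only [ne_eq, neg_eq_zero, one_ne_zero, not_false_eq_true, and_true]
      omega
    · simp [D.loopless]
    · have hij' : (j : ℕ) < i := hij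
      rw [D.symm, h j i hij, ite_ne_right_iff]
      simp only [ne_eq, neg_eq_zero, one_ne_zero, not_false_eq_true, and_true]
      omega

theorem d_ne_zero_iff {D : Bigraph n} {k : ℕ} (e : D.underlying ≃g branchedPath n k)
    (u v : Fin n) : D.d u v ≠ 0 ↔ (e u : ℕ) ≠ e v ∧
      ((((e u : ℕ) + 1 = e v ∧ (e v : ℕ) + 1 < n) ∨ ((e u : ℕ) = k ∧ (e v : ℕ) + 1 = n)) ∨
      (((e v : ℕ) + 1 = e u ∧ (e u : ℕ) + 1 < n) ∨ ((e v : ℕ) = k ∧ (e u : ℕ) + 1 = n))) := by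
  rw [← branchedPath_adj, e.map_adj_iff, underlying_adj]

/-- Both neighbours along the path count; the strict bound keeps the position after v on the path of
n - 1 vertices. -/
theorem two_le_deg_of_inner {D : Bigraph n} {k : ℕ} (e : D.underlying ≃g branchedPath n k)
    {v : Fin n} (h1 : 1 ≤ (e v : ℕ)) (h2 : (e v : ℕ) + 2 < n) : 2 ≤ D.deg v := by
  obtain ⟨w, hw⟩ := e.surjective ⟨(e v : ℕ) - 1, by omega⟩
  obtain ⟨w', hw'⟩ := e.surjective ⟨(e v : ℕ) + 1, by omega⟩
  rw [Fin.ext_iff] at hw hw'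
  simp only at hw hw'
  refine two_le_deg (w := w) (w' := w') ?_ ?_ ?_
  · rw [d_ne_zero_iff e]; omega
  · rw [d_ne_zero_iff e]; omega
  · rintro rfl; omega

theorem deg_lt_two_of_last {D : Bigraph n} {k : ℕ} (e : D.underlying ≃g branchedPath n k)
    {v : Fin n} (h : (e v : ℕ) + 1 = n) : D.deg v < 2 := by
  refine deg_lt_two fun w w' hw hw' => e.injective (Fin.ext ?_)
  rw [d_ne_zero_iff e] at hw hw'
  omega

/-- Position 0 would have a second neighbour if the branch were attached there. Among Dynkin
branchings k = 0 occurs only for n ≤ 2, where no second neighbour exists. -/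
theorem deg_lt_two_of_first {D : Bigraph n} {k : ℕ} (e : D.underlying ≃g branchedPath n k)
    {v : Fin n} (h : (e v : ℕ) = 0) (hk : 0 < k ∨ n ≤ 2) : D.deg v < 2 := by
  refine deg_lt_two fun w w' hw hw' => e.injective (Fin.ext ?_)
  rw [d_ne_zero_iff e] at hw hw'
  omega

/-- Everything except the two ends of the path and the attached vertex is an inner position. -/
theorem card_deg_lt_two_le {D : Bigraph n} {k : ℕ} (e : D.underlying ≃g branchedPath n k)
    (hn : 1 ≤ n) : (Finset.univ.filter fun v => D.deg v < 2).card ≤ 3 := by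
  refine (Finset.card_le_card (t := {e.symm ⟨0, hn⟩, e.symm ⟨n - 2, by omega⟩,
    e.symm ⟨n - 1, by omega⟩}) fun v hv => ?_).trans Finset.card_le_three
  have hv' : ¬ 2 ≤ D.deg v := by simpa using hv
  by_contra hne
  simp only [Finset.mem_insert, Finset.mem_singleton, not_or, RelIso.eq_symm_apply, Fin.ext_iff]
    at hne
  exact hv' (two_le_deg_of_inner e (by omega) (by omega))

/-- Completeness of the recognition. While the next position on the path is inner, it scores at
least 2, the attached vertex scores at most 1, and the previous position is already listed; so the
walk follows the path. Only positions n - 2 and n - 1 may come out exchanged. That requires both to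
hang at position n - 3, and then the exchange is a symmetry of the graph. -/
theorem GreedyList.matches {D : Bigraph n} {L : Fin n → Fin n} {k : ℕ} (hL : D.GreedyList L)
    (hD : ∀ a b, D.d a b = 0 ∨ D.d a b = -1) (e : D.underlying ≃g branchedPath n k)
    (hk : k ≤ n - 2) (hn : 1 ≤ n) (h0 : (e (L ⟨0, hn⟩) : ℕ) = 0) : D.Matches L k := by
  have hinj : ∀ p q : Fin n, (e (L p) : ℕ) = e (L q) → (p : ℕ) = q := fun p q h =>
    congrArg Fin.val (hL.injective (e.injective (Fin.ext h)))
  have hfix : ∀ p, ∀ hp : p + 2 < n, (e (L ⟨p, by omega⟩) : ℕ) = p := by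
    intro p
    induction p using Nat.strong_induction_on with
    | _ p ih =>
      intro hp
      obtain _ | p := p
      · exact h0
      set v := e.symm ⟨p + 1, by omega⟩ with hv
      have hev : (e v : ℕ) = p + 1 := by simp [hv]
      have hcur := ih p (by omega) (by omega)
      have hle := hL.score_le ⟨p, by omega⟩ ⟨p + 1, by omega⟩ rfl v fun r hr h => by
        have hr' : (r : ℕ) < p + 1 := hr
        have := ih r (by omega) (by omega)
        rw [Fin.eta, h] at this
        omega
      have hadj : D.d (L ⟨p, by omega⟩) v ≠ 0 := by rw [d_ne_zero_iff e]; omega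
      have h2 : 2 ≤ D.score (L ⟨p, by omega⟩) (L ⟨p + 1, by omega⟩) := by
        refine le_trans ?_ hle
        rw [score, if_neg hadj]
        exact two_le_deg_of_inner e (by omega) (by omega)
      have hadj' := adj_of_score_pos (Nat.two_pos.trans_le h2)
      rw [score, if_neg hadj'] at h2
      have hlast := mt (deg_lt_two_of_last e (v := L ⟨p + 1, by omega⟩)) (by omega)
      rw [d_ne_zero_iff e] at hadj'
      by_contra hne
      -- The only other neighbour left is the preceding position, excluded by injectivity. For p = 0
      -- the truncated `p - 1` is 0 and no such neighbour exists.
      have hprev := ih (p - 1) (by omega) (by omega)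
      have := hinj ⟨p - 1, by omega⟩ ⟨p + 1, by omega⟩
      simp only at this
      omega
  intro i j hij
  have hij' : (i : ℕ) < j := hij
  have hn2 : 2 ≤ n := by omega
  have hge : ∀ q : Fin n, n ≤ (q : ℕ) + 2 → n ≤ (e (L q) : ℕ) + 2 := by
    intro q hq
    by_contra! hlt
    have h1 := hfix _ hlt
    have := hinj _ _ h1
    simp only at this
    omega
  have ha := hge ⟨n - 2, by omega⟩ (by simp only; omega)
  have hb := hge ⟨n - 1, by omega⟩ (by simp only; omega)
  have hab := mt (hinj ⟨n - 2, by omega⟩ ⟨n - 1, by omega⟩) (by simp only; omega)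
  have ha' := (e (L ⟨n - 2, by omega⟩)).2
  have hb' := (e (L ⟨n - 1, by omega⟩)).2
  -- At position n - 3 the vertex in position n - 2 is an available neighbour, so the greedy choice
  -- has positive score and is a neighbour too. If it is the attached vertex, the branch is at n -
  -- 3.
  have hswap : (e (L ⟨n - 2, by omega⟩) : ℕ) + 1 = n → k + 3 = n := by
    intro h
    have hn3 : 3 ≤ n := by
      by_contra! h3
      obtain rfl : n = 2 := by omega
      simp only [Nat.sub_self] at h
      omega
    have hcur := hfix (n - 3) (by omega)
    set v := e.symm ⟨n - 2, by omega⟩ with hv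
    have hev : (e v : ℕ) = n - 2 := by simp [hv]
    have hle := hL.score_le ⟨n - 3, by omega⟩ ⟨n - 2, by omega⟩ (by simp only; omega) v
      fun r hr h => by
        have hr' : (r : ℕ) < n - 2 := hr
        have := hfix r (by omega)
        rw [Fin.eta, h] at this
        omega
    have hadj : D.d (L ⟨n - 3, by omega⟩) v ≠ 0 := by rw [d_ne_zero_iff e]; omega
    have hadj' := adj_of_score_pos ((score_pos hadj).trans_le hle)
    rw [d_ne_zero_iff e] at hadj'
    omega
  have hval : ∀ q : Fin n, ((q : ℕ) + 2 < n → (e (L q) : ℕ) = q) ∧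
      ((q : ℕ) + 2 = n → (e (L q) : ℕ) = e (L ⟨n - 2, by omega⟩)) ∧
      ((q : ℕ) + 1 = n → (e (L q) : ℕ) = e (L ⟨n - 1, by omega⟩)) := by
    refine fun q => ⟨hfix q, fun h => ?_, fun h => ?_⟩
    · rw [show q = ⟨n - 2, by omega⟩ from Fin.ext (by simp only; omega)]
    · rw [show q = ⟨n - 1, by omega⟩ from Fin.ext (by simp only; omega)]
  have hx : (e (L i) : ℕ) = i ∨ (k + 3 = n ∧ (i : ℕ) + 2 = n ∧ (e (L i) : ℕ) + 1 = n) := by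
    have := hval i
    omega
  have hy : (e (L j) : ℕ) = j ∨ (k + 3 = n ∧ (((j : ℕ) + 2 = n ∧ (e (L j) : ℕ) + 1 = n) ∨
      ((j : ℕ) + 1 = n ∧ (e (L j) : ℕ) + 2 = n))) := by
    have := hval j
    omega
  have hxy := mt (hinj i j) hij'.ne
  have hjn := j.2
  have key := d_ne_zero_iff e (L i) (L j)
  clear hval hswap hab ha hb ha' hb' hge hfix
  generalize (e (L i) : ℕ) = x at *
  generalize (e (L j) : ℕ) = y at *
  split_ifs with h
  · refine (hD _ _).resolve_left (key.2 ⟨hxy, ?_⟩)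
    rcases hx with rfl | hx <;> rcases hy with rfl | hy <;> omega
  · by_contra hne
    have := (key.1 hne).2
    rcases hx with rfl | hx <;> rcases hy with rfl | hy <;> omega

end Bigraph

/-! ### The recognition of Dynkin graphs on the machine. -/

namespace Machine

open Var Arr

variable {n : ℕ} {σ : State} {D : Bigraph n}

theorem runs_degreesProg (hn : 1 ≤ n) (hσn : σ.reg .n = n) (hσ : Stores σ D) :
    Runs degreesProg σ (100 * n ^ 2) fun τ => ∀ v : Fin n, τ.arr .deg v = D.deg v := by
  refine Runs.mono (T := n * ((3 + n * (30 + 14)) + 14)) (Runs.imp (Runs.forAll (N := n)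
    (fun k τ => ∀ v : Fin n, (v : ℕ) < k → τ.arr .deg v = D.deg v) hσn hn rfl (by simp) ?_) ?_)
    (by nlinarith)
  · intro k hk τ hi hτn hf hI
    refine Runs.seq (Q' := fun υ => υ = τ.setArr .deg k 0)
      (Runs.basic rfl (by simp [Cmd.run, NExpr.eval, hi])) ?_
    rintro _ - rfl
    refine Runs.imp (Runs.forAll (N := n) (fun l υ => (∀ v : Fin n, (v : ℕ) < k →
      υ.arr .deg v = D.deg v) ∧ υ.arr .deg k = (Finset.univ.filter fun w : Fin n =>
        (w : ℕ) < l ∧ D.d ⟨k, hk⟩ w ≠ 0).card) hτn hn rfl ?_ ?_) ?_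
    · refine ⟨fun v hv => ?_, by simp⟩
      simpa [hv.ne] using hI v hv
    · rintro l hl υ hj hυn hf' ⟨hI₁, hI₂⟩
      have hi' : υ.reg i = k := (hf'.reg _ rfl).trans hi
      have hυ : Stores υ D := (hσ.congr (hf.mat rfl)).congr (hf'.mat rfl)
      refine (Runs.basic rfl ?_).mono
        (by simp [Cmd.maxCost, NExpr.cost, BExpr.cost, RExpr.cost, edge])
      have hset : (Finset.univ.filter fun w : Fin n => (w : ℕ) < l + 1 ∧ D.d ⟨k, hk⟩ w ≠ 0) =
          if D.d ⟨k, hk⟩ ⟨l, hl⟩ ≠ 0 then insert ⟨l, hl⟩ (Finset.univ.filter fun w : Fin n =>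
            (w : ℕ) < l ∧ D.d ⟨k, hk⟩ w ≠ 0) else (Finset.univ.filter fun w : Fin n =>
            (w : ℕ) < l ∧ D.d ⟨k, hk⟩ w ≠ 0) := by
        ext w
        have hw : (w : ℕ) < l + 1 ↔ w = ⟨l, hl⟩ ∨ (w : ℕ) < l := by rw [Fin.ext_iff]; simp only; omega
        split_ifs with h
        · simp only [Finset.mem_filter, Finset.mem_univ, true_and, Finset.mem_insert, hw]
          constructor
          · tauto
          · rintro (rfl | h') <;> tauto
        · simp only [Finset.mem_filter, Finset.mem_univ, true_and, hw]
          constructor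
          · rintro ⟨rfl | h1, h2⟩
            · exact absurd h2 h
            · exact ⟨h1, h2⟩
          · tauto
      have htest : BExpr.Holds υ (.or (.eq i j) (.req (edge i j) (.lit 0))) ↔
          D.d ⟨k, hk⟩ ⟨l, hl⟩ = 0 := by
        simp only [BExpr.Holds, NExpr.eval, hi', hj]
        by_cases hkl : k = l
        · subst hkl; simp [D.loopless]
        · rw [hυ.eval_edge (e := i) (f := j) (a := ⟨k, hk⟩) (b := ⟨l, hl⟩) hi' hj (by simpa using hkl)]
          simp [hkl, RExpr.eval]
      by_cases h : D.d ⟨k, hk⟩ ⟨l, hl⟩ = 0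
      · simp only [Cmd.run, htest, h, if_true, State.arr_setReg]
        refine ⟨hI₁, ?_⟩
        rw [hset, if_neg (by simpa using h), hI₂]
      · simp only [Cmd.run, htest, h, if_false, State.arr_setReg, NExpr.eval, hi', State.arr_setArr,
          true_and, if_true]
        refine ⟨fun v hv => by rw [if_neg hv.ne, hI₁ v hv], ?_⟩
        rw [hset, if_pos h, Finset.card_insert_of_notMem (by simp), hI₂]
    · rintro υ - ⟨h1, h2⟩ v hv
      rcases Nat.lt_succ_iff_lt_or_eq.1 hv with h | h
      · exact h1 v h
      · obtain rfl : v = ⟨k, hk⟩ := Fin.ext h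
        simpa [Bigraph.deg] using h2
  · exact fun τ _ h v => h v v.2

/-- One step of the search for the next vertex of the list. -/
theorem runs_nextVertex (hn : 1 ≤ n) (hσn : σ.reg .n = n) (hσ : Stores σ D)
    (hdeg : ∀ v : Fin n, σ.arr .deg v = D.deg v) {u : Fin n} (hu : σ.reg cur = u)
    (hvu : σ.arr visited u ≠ 0) (hb : σ.reg best = 0)
    (hex : ∃ v : Fin n, σ.arr visited v = 0) :
    Runs (forAll j (.ite (.eq (.arr visited j) 0)
        (.ite (.req (edge cur j) (.lit 0)) (.assign score 0) (.assign score (.arr deg j)) ;;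
          .ite (.lt score best) .skip (.assign next j ;; .assign best score))
        .skip)) σ (60 * n) fun τ => ∃ w : Fin n, τ.reg next = w ∧ σ.arr visited w = 0 ∧
          ∀ v : Fin n, σ.arr visited v = 0 → D.score u v ≤ D.score u w := by
  -- The first alternative says that no candidate has been seen yet. A tie replaces the current
  -- choice, so a first candidate of score 0 is recorded although `best` starts at 0.
  refine Runs.mono (Runs.imp (Runs.forAll (T := 46) (N := n) (fun l τ =>
    (∀ v : Fin n, (v : ℕ) < l → σ.arr visited v = 0 → D.score u v ≤ τ.reg best) ∧
    ((τ.reg best = 0 ∧ ∀ v : Fin n, (v : ℕ) < l → σ.arr visited v ≠ 0) ∨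
      ∃ w : Fin n, τ.reg next = w ∧ σ.arr visited w = 0 ∧ τ.reg best = D.score u w))
    hσn hn rfl ?_ ?_) ?_) (by omega)
  · simp [hb]
  · rintro l hl τ hj hτn hf ⟨hI₁, hI₂⟩
    have hvis : τ.arr visited = σ.arr visited := hf.arr _ rfl
    have hτ : Stores τ D := hσ.congr (hf.mat rfl)
    have hcur : τ.reg cur = u := (hf.reg _ rfl).trans hu
    have hdegτ : τ.arr .deg l = D.deg ⟨l, hl⟩ := by rw [hf.arr .deg rfl]; exact hdeg ⟨l, hl⟩
    have hlt : ∀ v : Fin n, (v : ℕ) < l + 1 → v = ⟨l, hl⟩ ∨ (v : ℕ) < l := by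
      intro v hv; rw [Fin.ext_iff]; simp only; omega
    refine (Runs.basic rfl ?_).mono
      (by simp [Cmd.maxCost, NExpr.cost, BExpr.cost, RExpr.cost, edge])
    by_cases hvl : σ.arr visited l = 0
    -- The current vertex is visited, which keeps the read off the diagonal, where the matrix holds
    -- 1.
    · have hne : u ≠ ⟨l, hl⟩ := by rintro rfl; exact hvu hvl
      have hscore : (Cmd.ite (.req (edge cur j) (.lit 0)) (.assign score 0)
          (.assign score (.arr .deg j))).run τ = τ.setReg score (D.score u ⟨l, hl⟩) := by
        have htest : BExpr.Holds τ (.req (edge cur j) (.lit 0)) ↔ D.d u ⟨l, hl⟩ = 0 := by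
          simp only [BExpr.Holds]
          rw [hτ.eval_edge (e := cur) (f := j) (b := ⟨l, hl⟩) hcur hj hne]
          simp [RExpr.eval]
        by_cases h : D.d u ⟨l, hl⟩ = 0
        · simp only [Cmd.run, htest, h, Bigraph.score, if_true]
          rfl
        · simp [Cmd.run, htest, h, Bigraph.score, NExpr.eval, hj, hdegτ]
      rw [Cmd.run, if_pos (by simpa [BExpr.Holds, NExpr.eval, hj, hvis] using hvl), Cmd.run, hscore]
      by_cases h : D.score u ⟨l, hl⟩ < τ.reg best
      · simp only [Cmd.run, BExpr.Holds, NExpr.eval, State.reg_setReg, if_true, reduceCtorEq,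
          if_false, h]
        refine ⟨fun v hv hv' => ?_, .inr (hI₂.resolve_left fun h' => by omega)⟩
        rcases hlt v hv with rfl | hv
        · exact h.le
        · exact hI₁ v hv hv'
      · simp only [Cmd.run, BExpr.Holds, NExpr.eval, State.reg_setReg, if_true, reduceCtorEq,
          if_false, h]
        refine ⟨fun v hv hv' => ?_, .inr ⟨⟨l, hl⟩, hj, hvl, rfl⟩⟩
        rcases hlt v hv with rfl | hv
        · exact le_rfl
        · exact (hI₁ v hv hv').trans (by omega)
    · rw [Cmd.run, if_neg (by simpa [BExpr.Holds, NExpr.eval, hj, hvis] using hvl)]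
      simp only [Cmd.run, State.reg_setReg, reduceCtorEq, if_false]
      refine ⟨fun v hv hv' => ?_, hI₂.imp_left fun h => ⟨h.1, fun v hv => ?_⟩⟩
      · rcases hlt v hv with rfl | hv
        · exact absurd hv' hvl
        · exact hI₁ v hv hv'
      · rcases hlt v hv with rfl | hv
        · exact hvl
        · exact h.2 v hv
  · rintro τ - ⟨h1, ⟨-, h2⟩ | ⟨w, hw, hw', hb'⟩⟩
    · obtain ⟨v, hv⟩ := hex
      exact absurd hv (h2 v v.2)
    · exact ⟨w, hw, hw', fun v hv => hb' ▸ h1 v v.2 hv⟩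

/-- The list is modelled by a function on ℕ whose first p values matter. The array `visited` marks
exactly these values, so a vertex returned by `runs_nextVertex` is new and keeps the list injective
and greedy. -/
theorem runs_labelProg (hn : 1 ≤ n) (hσn : σ.reg .n = n) (hσ : Stores σ D)
    (hdeg : ∀ v : Fin n, σ.arr .deg v = D.deg v) {u : Fin n} (hu : σ.reg start = u) :
    Runs labelProg σ (200 * n ^ 2) fun τ => ∃ L : Fin n → Fin n,
      (∀ p : Fin n, τ.arr label p = L p) ∧ L ⟨0, hn⟩ = u ∧ D.GreedyList L := by
  refine Runs.mono (T := n * (3 + 14) + (3 + (3 + (2 + (n * (3 + 1 + (5 + (2 + (60 * n +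
    (3 + (3 + 4)))))) + (3 + 1)))))) ?_ (by nlinarith)
  refine Runs.seq (Runs.forAll (N := n) (fun k τ => ∀ i < k, τ.arr visited i = 0) hσn hn rfl
    (by simp) ?_) ?_
  · intro k hk τ hi hτn hf hI
    refine (Runs.basic rfl ?_).mono (by simp [Cmd.maxCost, NExpr.cost])
    intro l hl
    simp only [Cmd.run, NExpr.eval, hi, State.arr_setReg, State.arr_setArr, true_and]
    split_ifs with h
    · rfl
    · exact hI l (by omega)
  intro τ hf hvis
  have hτu : τ.reg start = u := (hf.reg _ rfl).trans hu
  refine Runs.seq (Q' := fun υ => υ = τ.setArr label 0 u)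
    (Runs.basic rfl (by simp [Cmd.run, NExpr.eval, hτu])) ?_
  rintro _ - rfl
  refine Runs.seq (Q' := fun υ => υ = (τ.setArr label 0 u).setArr visited u 1)
    (Runs.basic rfl (by simp [Cmd.run, NExpr.eval, hτu])) ?_
  rintro _ - rfl
  refine Runs.seq (Q' := fun υ => υ = ((τ.setArr label 0 u).setArr visited u 1).setReg pos 1)
    (Runs.basic rfl rfl) ?_
  rintro _ - rfl
  classical
  refine Runs.mono (Runs.loop (T := 5 + (2 + (60 * n + (3 + (3 + 4)))))
    (c := .lt pos Var.n) (I := fun r υ => ∃ (p : ℕ) (L : ℕ → Fin n),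
    υ.reg .n = n ∧ υ.reg pos = p ∧ 1 ≤ p ∧ p + r = n ∧ Stores υ D ∧
    (∀ v : Fin n, υ.arr .deg v = D.deg v) ∧ (∀ q < p, υ.arr label q = L q) ∧
    (∀ q < p, ∀ q' < p, L q = L q' → q = q') ∧ L 0 = u ∧
    (∀ v : Fin n, υ.arr visited v = if ∃ q < p, L q = v then 1 else 0) ∧
    ∀ q, q + 1 < p → ∀ v, (∀ r < q + 1, L r ≠ v) → D.score (L q) v ≤ D.score (L q) (L (q + 1)))
    (n - 1) ?_ ?_ ?_) (Nat.add_le_add (Nat.mul_le_mul_right _ (Nat.sub_le _ _)) le_rfl)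
  · rintro r υ ⟨p, L, hυn, hp, hp1, hr, hυ, hυdeg, hlab, hinj, hL0, hυvis, hgr⟩ hc
    simp only [BExpr.Holds, NExpr.eval, hυn, hp] at hc
    refine ⟨r - 1, by omega, ?_⟩
    have hlast : υ.arr label (p - 1) = L (p - 1) := hlab _ (by omega)
    refine Runs.seq (Q' := fun υ' => υ' = υ.setReg cur (L (p - 1)))
      (Runs.basic rfl (by simp [Cmd.run, NExpr.eval, hp, hlast])) ?_
    rintro _ - rfl
    refine Runs.seq (Q' := fun υ' => υ' = (υ.setReg cur (L (p - 1))).setReg best 0)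
      (Runs.basic rfl rfl) ?_
    rintro _ - rfl
    have hex : ∃ v : Fin n, υ.arr visited v = 0 := by
      -- Fewer than n vertices are listed, so some vertex is unvisited.
      have hcard : ((Finset.range p).image L).card < (Finset.univ : Finset (Fin n)).card := by
        refine Finset.card_image_le.trans_lt ?_
        simpa using hc
      obtain ⟨v, -, hv⟩ := Finset.exists_mem_notMem_of_card_lt_card hcard
      refine ⟨v, ?_⟩
      rw [hυvis, if_neg]
      rintro ⟨q, hq, rfl⟩
      exact hv (Finset.mem_image_of_mem _ (Finset.mem_range.2 hq))
    refine Runs.seq (runs_nextVertex (σ := (υ.setReg cur (L (p - 1))).setReg best 0) hn (by simpa using hυn) (hυ.congr rfl) hυdeg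
      (u := L (p - 1)) (by simp) ?_ (by simp) hex) ?_
    · simp only [State.arr_setReg, hυvis]
      rw [if_pos ⟨p - 1, by omega, rfl⟩]
      exact one_ne_zero
    rintro υ' hf' ⟨w, hw, hwvis, hwbest⟩
    simp only [State.arr_setReg] at hwvis hwbest
    have hnew : ∀ v : Fin n, υ.arr visited v = 0 ↔ ∀ q < p, L q ≠ v := by
      intro v
      rw [hυvis, ite_eq_right_iff]
      simp
    have hp' : υ'.reg pos = p := by simp [hf'.reg pos rfl, hp]
    have hn' : υ'.reg .n = n := by simp [hf'.reg .n rfl, hυn]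
    have hvis' : υ'.arr visited = υ.arr visited := hf'.arr _ rfl
    have hlab' : υ'.arr label = υ.arr label := hf'.arr _ rfl
    have hdeg' : υ'.arr .deg = υ.arr .deg := hf'.arr _ rfl
    have hLp : ∀ q < p, Function.update L p w q = L q := fun q hq => by
      rw [Function.update_of_ne hq.ne]
    have hold := (hnew w).1 hwvis
    have hrun : (Cmd.store label pos next ;; .store visited next 1 ;; incr pos).run υ' =
        ((υ'.setArr label p w).setArr visited w 1).setReg pos (p + 1) := by
      simp only [incr, Cmd.run, NExpr.eval, hp', hw, State.reg_setArr]
    refine (Runs.basic (p := .store label pos next ;; .store visited next 1 ;; incr pos) rfl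
      ?_).mono (by simp [incr, Cmd.maxCost, NExpr.cost])
    rw [hrun]
    refine ⟨p + 1, Function.update L p w, by simp [hn'], by simp, by omega, by omega,
      hυ.congr (hf'.mat rfl), fun v => ?_, fun q hq => ?_, fun q hq q' hq' h => ?_, ?_,
      fun v => ?_, fun q hq v hv => ?_⟩
    · simp [hdeg', hυdeg]
    · by_cases h : q = p
      · simp [h]
      · simp [h, hlab', hlab q (by omega)]
    · by_cases h1 : q = p <;> by_cases h2 : q' = p
      · omega
      · subst h1
        rw [Function.update_self, hLp q' (by omega)] at h
        exact absurd h.symm (hold q' (by omega))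
      · subst h2
        rw [Function.update_self, hLp q (by omega)] at h
        exact absurd h (hold q (by omega))
      · rw [hLp q (by omega), hLp q' (by omega)] at h
        exact hinj q (by omega) q' (by omega) h
    · rw [hLp 0 (by omega), hL0]
    · have hiff : (∃ q < p + 1, Function.update L p w q = v) ↔ v = w ∨ ∃ q < p, L q = v := by
        constructor
        · rintro ⟨q, hq, rfl⟩
          by_cases h : q = p
          · left; simp [h]
          · right; exact ⟨q, by omega, (hLp q (by omega)).symm⟩
        · rintro (rfl | ⟨q, hq, rfl⟩)
          · exact ⟨p, by omega, by simp⟩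
          · exact ⟨q, by omega, hLp q hq⟩
      simp only [hiff, State.arr_setReg, State.arr_setArr, true_and, reduceCtorEq, false_and,
        if_false, hvis', hυvis, Fin.val_inj]
      by_cases h : v = w <;> simp [h]
    · rw [hLp q (by omega)]
      by_cases h : q + 1 = p
      · rw [h, Function.update_self]
        obtain rfl : q = p - 1 := by omega
        refine hwbest v ((hnew v).2 fun q hq => ?_)
        rw [← hLp q hq]
        exact hv q (by omega)
      · rw [hLp (q + 1) (by omega)]
        refine hgr q (by omega) v fun r hr => ?_
        rw [← hLp r (by omega)]
        exact hv r hr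
  · rintro r υ ⟨p, L, hυn, hp, hp1, hr, hυ, hυdeg, hlab, hinj, hL0, hυvis, hgr⟩ hc
    simp only [BExpr.Holds, NExpr.eval, hυn, hp] at hc
    obtain rfl : p = n := by omega
    refine ⟨fun q => L q, fun q => hlab q q.2, hL0, fun q q' h => Fin.ext (hinj q q.2 q' q'.2 h),
      fun q q' hq v hv => ?_⟩
    have := hgr q (by omega) v fun r hr => hv ⟨r, by omega⟩ (by rw [Fin.lt_def]; simp only; omega)
    rwa [hq] at this
  · refine ⟨1, fun _ => u, ?_, by simp, le_rfl, by omega, hσ.congr (hf.mat rfl), fun v => ?_,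
      fun q hq => ?_, fun q hq q' hq' _ => by omega, rfl, fun v => ?_, fun q hq => by omega⟩
    · simp [hf.reg .n rfl, hσn]
    · simp [hf.arr .deg rfl, hdeg]
    · obtain rfl : q = 0 := by omega
      simp
    · simp only [State.arr_setReg, State.arr_setArr, true_and, reduceCtorEq, false_and,
        if_false, hvis v v.2, Fin.val_inj, Nat.lt_one_iff, exists_eq_left, eq_comm]

/-- The flag `good` is the conjunction over the pairs scanned so far. `result` is never reset here,
so successive comparisons accumulate a disjunction. -/
theorem runs_compareProg (hn : 1 ≤ n) (hσn : σ.reg .n = n) (hσ : Stores σ D)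
    {L : Fin n → Fin n} (hL : Function.Injective L) (hlab : ∀ p : Fin n, σ.arr label p = L p) :
    Runs compareProg σ (200 * n ^ 2) fun τ =>
      τ.reg result = 1 ↔ σ.reg result = 1 ∨ D.Matches L (σ.reg k) := by
  have h2 : 1 ≤ n ^ 2 := Nat.one_le_pow _ _ hn
  refine Runs.mono (T := 2 + (n ^ 2 * (70 + 28) + 10)) ?_ (by nlinarith)
  refine Runs.seq (Q' := fun τ => τ = σ.setReg good 1) (Runs.basic rfl rfl) ?_
  rintro _ - rfl
  let OK (u v : Fin n) : Prop := u < v → D.d (L u) (L v) =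
    if ((v : ℕ) = u + 1 ∧ (v : ℕ) + 1 < n) ∨ ((v : ℕ) + 1 = n ∧ (u : ℕ) = σ.reg k) then -1 else 0
  refine Runs.seq (Runs.forAll_pair (N := n) (fun l τ => τ.reg good = 1 ↔
    ∀ u v : Fin n, (u : ℕ) * n + v < l → OK u v) (by simpa using hσn) hn rfl ?_ ?_ ?_) ?_
  · rintro l τ x v h (rfl | rfl) <;> simpa using h
  · simp
  · intro i' j' τ hi' hj' hi hj hτn hf hI
    have hk : τ.reg k = σ.reg k := by rw [hf.reg k rfl]; simp
    have hτ : Stores τ D := hσ.congr (hf.mat rfl)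
    have hlabτ : τ.arr label = σ.arr label := hf.arr _ rfl
    refine (Runs.basic rfl ?_).mono
      (by simp [Cmd.maxCost, NExpr.cost, BExpr.cost, RExpr.cost, edge])
    have hstep : (∀ u v : Fin n, (u : ℕ) * n + v < i' * n + j' + 1 → OK u v) ↔
        (∀ u v : Fin n, (u : ℕ) * n + v < i' * n + j' → OK u v) ∧ OK ⟨i', hi'⟩ ⟨j', hj'⟩ := by
      refine ⟨fun h => ⟨fun u v huv => h u v (by omega), h _ _ (by simp)⟩, fun h u v huv => ?_⟩
      by_cases hlt : (u : ℕ) * n + v < i' * n + j'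
      · exact h.1 u v hlt
      · have h1 := (lex_lt_iff (i := (u : ℕ)) (k := i') v.2 hj').not.1 hlt
        have h2 := (lex_lt_iff (i := i') (k := (u : ℕ)) hj' v.2).not.1 (by omega)
        obtain rfl : u = ⟨i', hi'⟩ := Fin.ext (by simp only; omega)
        obtain rfl : v = ⟨j', hj'⟩ := Fin.ext (by simp only; omega)
        exact h.2
    rw [hstep, ← hI]
    by_cases hij : i' < j'
    · have hne : L ⟨i', hi'⟩ ≠ L ⟨j', hj'⟩ := fun h => by
        have := congrArg Fin.val (hL h); simp only at this; omega
      have hedge : (edge (.arr label i) (.arr label j)).eval τ = D.d (L ⟨i', hi'⟩) (L ⟨j', hj'⟩) := by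
        refine hτ.eval_edge ?_ ?_ hne
        · simp only [NExpr.eval, hi, hlabτ]; exact hlab ⟨i', hi'⟩
        · simp only [NExpr.eval, hj, hlabτ]; exact hlab ⟨j', hj'⟩
      have hcond : BExpr.Holds τ (.or (.and (.eq j (.add i 1)) (.lt (.add j 1) Var.n))
          (.and (.eq (.add j 1) Var.n) (.eq i k))) ↔
          (j' = i' + 1 ∧ j' + 1 < n) ∨ (j' + 1 = n ∧ i' = σ.reg k) := by
        rw [← hk, ← hi, ← hj, ← hτn]; exact Iff.rfl
      have hOK : OK ⟨i', hi'⟩ ⟨j', hj'⟩ ↔ D.d (L ⟨i', hi'⟩) (L ⟨j', hj'⟩) =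
          if (j' = i' + 1 ∧ j' + 1 < n) ∨ (j' + 1 = n ∧ i' = σ.reg k) then -1 else 0 :=
        ⟨fun h => h hij, fun h _ => h⟩
      rw [hOK, Cmd.run, if_pos (by simpa [BExpr.Holds, NExpr.eval, hi, hj] using hij), Cmd.run]
      by_cases h : (j' = i' + 1 ∧ j' + 1 < n) ∨ (j' + 1 = n ∧ i' = σ.reg k)
      · rw [if_pos (hcond.2 h), if_pos h]
        by_cases hd : D.d (L ⟨i', hi'⟩) (L ⟨j', hj'⟩) = -1
        · simp [Cmd.run, BExpr.Holds, hedge, RExpr.eval, hd]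
        · have : ¬ (D.d (L ⟨i', hi'⟩) (L ⟨j', hj'⟩) : ℝ) = -1 := by exact_mod_cast hd
          simp [Cmd.run, BExpr.Holds, hedge, RExpr.eval, this, hd, NExpr.eval]
      · rw [if_neg (hcond.not.2 h), if_neg h]
        by_cases hd : D.d (L ⟨i', hi'⟩) (L ⟨j', hj'⟩) = 0
        · simp [Cmd.run, BExpr.Holds, hedge, RExpr.eval, hd]
        · simp [Cmd.run, BExpr.Holds, hedge, RExpr.eval, hd, NExpr.eval]
    · have hOK : OK ⟨i', hi'⟩ ⟨j', hj'⟩ := fun h => absurd h hij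
      rw [Cmd.run, if_neg (by simpa [BExpr.Holds, NExpr.eval, hi, hj] using hij)]
      simp [Cmd.run, hOK]
  · intro τ hf hI
    have hres : τ.reg result = σ.reg result := by rw [hf.reg result rfl]; simp
    have hmat : D.Matches L (σ.reg k) ↔ τ.reg good = 1 := by
      rw [hI]
      exact ⟨fun h u v _ huv => h u v huv, fun h u v huv => h u v (lex_lt_sq u.2 v.2) huv⟩
    refine (Runs.basic rfl ?_).mono (by simp [Cmd.maxCost, NExpr.cost, BExpr.cost])
    rw [hmat, Cmd.run]
    by_cases h : τ.reg good = 1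
    · rw [if_pos (show BExpr.Holds τ (.eq good 1) from h)]; simp [Cmd.run, h, NExpr.eval]
    · rw [if_neg (show ¬ BExpr.Holds τ (.eq good 1) from h)]; simp [Cmd.run, h, hres]

end Machine

namespace Machine

open Var Arr

variable {n : ℕ} {σ : State} {D : Bigraph n}

theorem runs_compareProg_of_test (hn : 1 ≤ n) (hσn : σ.reg .n = n) (hσ : Stores σ D)
    {L : Fin n → Fin n} (hL : Function.Injective L) (hlab : ∀ p : Fin n, σ.arr label p = L p)
    (t : BExpr) (κ : ℕ) :
    Runs (.ite t (.assign k (.lit κ) ;; compareProg) .skip) σ (t.cost + 204 * n ^ 2) fun τ =>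
      τ.reg result = 1 ↔ σ.reg result = 1 ∨ (t.Holds σ ∧ D.Matches L κ) := by
  have h2 : 1 ≤ n ^ 2 := Nat.one_le_pow _ _ hn
  refine Runs.mono (Runs.ite (T := 2 + 200 * n ^ 2) (fun h => ?_) fun h => ?_) (by omega)
  · refine Runs.seq (Q' := fun υ => υ = σ.setReg k κ) (Runs.basic rfl rfl) ?_
    rintro _ - rfl
    refine (runs_compareProg (σ := σ.setReg k κ) hn (by simpa using hσn) (hσ.congr rfl) hL
      hlab).imp fun τ _ h' => ?_
    simpa [h] using h'
  · exact (Runs.basic rfl (by simp [Cmd.run, h])).mono (by simp [Cmd.maxCost]; omega)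

/-- One attempt to recognise the Dynkin graph. -/
theorem runs_attempt (hn : 1 ≤ n) (hσn : σ.reg .n = n) (hσ : Stores σ D)
    (hdeg : ∀ v : Fin n, σ.arr .deg v = D.deg v) {u : Fin n} (hu : σ.reg start = u) :
    Runs (incr tries ;; labelProg ;; .assign k (.sub Var.n 2) ;; compareProg ;;
      .ite (.lt 3 Var.n) (.assign k 1 ;; compareProg) .skip ;;
      .ite (.and (.lt 5 Var.n) (.lt Var.n 9)) (.assign k 2 ;; compareProg) .skip) σ
      (900 * n ^ 2) fun τ => τ.reg tries = σ.reg tries + 1 ∧ ∃ L : Fin n → Fin n,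
        L ⟨0, hn⟩ = u ∧ D.GreedyList L ∧
        (τ.reg result = 1 ↔ σ.reg result = 1 ∨ ∃ κ, IsDynkinBranching n κ ∧ D.Matches L κ) := by
  have h2 : 1 ≤ n ^ 2 := Nat.one_le_pow _ _ hn
  refine Runs.mono (T := 4 + (200 * n ^ 2 + (4 + (200 * n ^ 2 + ((3 + 204 * n ^ 2) +
    (7 + 204 * n ^ 2)))))) ?_ (by omega)
  refine Runs.seq (Q' := fun υ => υ = σ.setReg tries (σ.reg tries + 1)) (Runs.basic rfl rfl) ?_
  rintro _ - rfl
  refine Runs.seq (runs_labelProg (σ := σ.setReg tries (σ.reg tries + 1)) hn (by simpa using hσn)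
    (hσ.congr rfl) hdeg (by simpa using hu)) ?_
  rintro τ₁ hf₁ ⟨L, hlab, hLu, hL⟩
  have hn₁ : τ₁.reg .n = n := by simp [hf₁.reg .n rfl, hσn]
  refine Runs.seq (Q' := fun υ => υ = τ₁.setReg k (n - 2))
    (Runs.basic rfl (by simp [Cmd.run, NExpr.eval, hn₁])) ?_
  rintro _ - rfl
  have hσ₁ : Stores (τ₁.setReg k (n - 2)) D := hσ.congr (hf₁.mat rfl)
  refine Runs.seq (runs_compareProg hn (by simpa using hn₁) hσ₁ hL.injective hlab) ?_
  intro τ₂ hf₂ h₂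
  have hn₂ : τ₂.reg .n = n := by simp [hf₂.reg .n rfl, hn₁]
  have hσ₂ : Stores τ₂ D := hσ₁.congr (hf₂.mat rfl)
  have hlab₂ : ∀ p : Fin n, τ₂.arr label p = L p := by rw [hf₂.arr label rfl]; exact hlab
  refine Runs.seq (runs_compareProg_of_test hn hn₂ hσ₂ hL.injective hlab₂ _ _) ?_
  intro τ₃ hf₃ h₃
  have hn₃ : τ₃.reg .n = n := by rw [hf₃.reg .n rfl, hn₂]
  have hσ₃ : Stores τ₃ D := hσ₂.congr (hf₃.mat rfl)
  have hlab₃ : ∀ p : Fin n, τ₃.arr label p = L p := by rw [hf₃.arr label rfl]; exact hlab₂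
  refine (runs_compareProg_of_test hn hn₃ hσ₃ hL.injective hlab₃ _ _).imp ?_
  intro τ₄ hf₄ h₄
  refine ⟨?_, L, hLu, hL, ?_⟩
  · simp [hf₄.reg tries rfl, hf₃.reg tries rfl, hf₂.reg tries rfl, hf₁.reg tries rfl]
  · have hr : (τ₁.setReg k (n - 2)).reg result = σ.reg result := by simp [hf₁.reg result rfl]
    have e3 : BExpr.Holds τ₂ (.lt 3 Var.n) ↔ 3 < n := by rw [← hn₂]; exact Iff.rfl
    have e5 : BExpr.Holds τ₃ (.and (.lt 5 Var.n) (.lt Var.n 9)) ↔ 5 < n ∧ n < 9 := by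
      rw [← hn₃]; exact Iff.rfl
    rw [h₄, h₃, h₂, hr, e3, e5]
    simp only [State.reg_setReg, if_true, IsDynkinBranching, or_and_right, exists_or, exists_eq_left,
      and_assoc, exists_and_left, or_assoc]

/-- The counter `tries` is at most the number of low-degree vertices already passed, so if there are
at most three in all, each of them is tried as a start. Charging a full O(n²) attempt to every
vertex is wasteful but stays within O(n³). -/
theorem runs_dynkinProg (hn : 1 ≤ n) (hσn : σ.reg .n = n) (hσ : Stores σ D) :
    Runs dynkinProg σ (1100 * n ^ 3) fun τ => τ.reg result = 1 ↔ D.IsDynkin := by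
  have h1 : n ≤ n ^ 2 := by nlinarith
  have h2 : n ^ 2 ≤ n ^ 3 := Nat.pow_le_pow_right hn (by omega)
  refine Runs.mono (T := 100 * n ^ 2 + (2 + (2 + n * ((8 + 1 + 900 * n ^ 2) + 14)))) ?_ (by nlinarith)
  refine Runs.seq (runs_degreesProg hn hσn hσ) ?_
  intro τ₁ hf₁ hdeg
  refine Runs.seq (Q' := fun υ => υ = τ₁.setReg result 0) (Runs.basic rfl rfl) ?_
  rintro _ - rfl
  refine Runs.seq (Q' := fun υ => υ = (τ₁.setReg result 0).setReg tries 0) (Runs.basic rfl rfl) ?_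
  rintro _ - rfl
  have hσ₁ : Stores τ₁ D := hσ.congr (hf₁.mat rfl)
  refine Runs.imp (Runs.forAll (N := n) (fun l τ => (τ.reg result = 1 → D.IsDynkin) ∧
    τ.reg tries ≤ (Finset.univ.filter fun v : Fin n => (v : ℕ) < l ∧ D.deg v < 2).card ∧
    ((Finset.univ.filter fun v => D.deg v < 2).card ≤ 3 → ∀ v : Fin n, (v : ℕ) < l →
      D.deg v < 2 → (∀ L : Fin n → Fin n, L ⟨0, hn⟩ = v → D.GreedyList L →
        ∃ κ, IsDynkinBranching n κ ∧ D.Matches L κ) → τ.reg result = 1))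
    (by simp [hf₁.reg .n rfl, hσn]) hn rfl (by simp) ?_) ?_
  · rintro l hl τ hst hτn hf ⟨hI₁, hI₂, hI₃⟩
    have hτ : Stores τ D := hσ₁.congr (hf.mat rfl)
    have hdegτ : ∀ v : Fin n, τ.arr .deg v = D.deg v := by rw [hf.arr .deg rfl]; exact hdeg
    have hlt : ∀ v : Fin n, (v : ℕ) < l + 1 → v = ⟨l, hl⟩ ∨ (v : ℕ) < l := by
      intro v hv; rw [Fin.ext_iff]; simp only; omega
    have htest : BExpr.Holds τ (.and (.lt (.arr .deg start) 2) (.lt tries 3)) ↔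
        D.deg ⟨l, hl⟩ < 2 ∧ τ.reg tries < 3 := by
      rw [← hdegτ]
      simp only [BExpr.Holds, NExpr.eval, hst]
    have hmono : (Finset.univ.filter fun v : Fin n => (v : ℕ) < l ∧ D.deg v < 2) ⊆
        Finset.univ.filter fun v : Fin n => (v : ℕ) < l + 1 ∧ D.deg v < 2 := by
      intro v; simp only [Finset.mem_filter, Finset.mem_univ, true_and]; omega
    refine Runs.ite (c := .and (.lt (.arr .deg start) 2) (.lt tries 3)) (fun h => ?_) fun h => ?_
    · rw [htest] at h
      refine (runs_attempt hn hτn hτ hdegτ (u := ⟨l, hl⟩) hst).imp ?_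
      rintro υ - ⟨htr, L, hLu, hL, hres⟩
      simp only [State.reg_setReg, reduceCtorEq, if_false]
      refine ⟨fun h' => ?_, ?_, fun h3 v hv hv2 hgood => ?_⟩
      · rcases hres.1 h' with h' | ⟨κ, hκ, hM⟩
        · exact hI₁ h'
        · exact hM.isDynkin hn hL.injective hκ
      · rw [htr]
        refine (Nat.add_le_add_right hI₂ 1).trans (Finset.card_lt_card
          (Finset.ssubset_iff_of_subset hmono |>.2 ⟨⟨l, hl⟩, by simpa using h.1, by simp⟩))
      · rw [hres]
        rcases hlt v hv with rfl | hv
        · exact .inr (hgood L hLu hL)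
        · exact .inl (hI₃ h3 v hv hv2 hgood)
    · rw [htest] at h
      refine (Runs.basic rfl ?_).mono (by simp [Cmd.maxCost]; omega)
      simp only [Cmd.run, State.reg_setReg, reduceCtorEq, if_false]
      refine ⟨hI₁, hI₂.trans (Finset.card_le_card hmono), fun h3 v hv hv2 hgood => ?_⟩
      rcases hlt v hv with rfl | hv
      -- Skipping this vertex because three attempts were used up would give four vertices of low
      -- degree.
      · refine absurd ⟨hv2, ?_⟩ h
        refine hI₂.trans_lt (lt_of_lt_of_le (Finset.card_lt_card (t := Finset.univ.filter
          fun v : Fin n => D.deg v < 2) ?_) h3)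
        refine (Finset.ssubset_iff_of_subset ?_).2 ⟨⟨l, hl⟩, by simpa using hv2, by simp⟩
        intro v; simp
      · exact hI₃ h3 v hv hv2 hgood
  · rintro τ - ⟨h1, -, h3⟩
    refine ⟨h1, fun hD => ?_⟩
    obtain ⟨hd, κ, hκ, ⟨e⟩⟩ := (D.isDynkin_iff hn).1 hD
    have hκ' : κ ≤ n - 2 ∧ (0 < κ ∨ n ≤ 2) := by
      unfold IsDynkinBranching at hκ; omega
    refine h3 (Bigraph.card_deg_lt_two_le e hn) (e.symm ⟨0, hn⟩) (Fin.is_lt _)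
      (Bigraph.deg_lt_two_of_first e (by simp) hκ'.2) fun L hL0 hL => ⟨κ, hκ, ?_⟩
    exact hL.matches hd e hκ'.1 hn (by simp [hL0])

/-! ## The two tests -/

theorem runs_boundPosProg (hσn : σ.reg .n = n) :
    Runs boundPosProg σ 60 fun τ => τ.reg limit = boundPos n := by
  refine (Runs.basic rfl ?_).mono (by decide)
  have e3 : BExpr.Holds σ (.lt Var.n 4) ↔ n ≤ 3 := by
    rw [← hσn]; exact Nat.lt_succ_iff
  have e6 : BExpr.Holds σ (.eq Var.n 6) ↔ n = 6 := by rw [← hσn]; exact Iff.rfl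
  have e7 : BExpr.Holds σ (.eq Var.n 7) ↔ n = 7 := by rw [← hσn]; exact Iff.rfl
  have e8 : BExpr.Holds σ (.eq Var.n 8) ↔ n = 8 := by rw [← hσn]; exact Iff.rfl
  simp only [Cmd.run, e3, e6, e7, e8, boundPos, boundPosProg]
  split_ifs <;> simp [NExpr.eval, hσn, sq]

theorem runs_boundPosSincereProg (hσn : σ.reg .n = n) :
    Runs boundPosSincereProg σ 60 fun τ => τ.reg limit = boundPosSincere n := by
  refine (Runs.basic rfl ?_).mono (by decide)
  have e3 : BExpr.Holds σ (.lt Var.n 4) ↔ n ≤ 3 := by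
    rw [← hσn]; exact Nat.lt_succ_iff
  have e6 : BExpr.Holds σ (.eq Var.n 6) ↔ n = 6 := by rw [← hσn]; exact Iff.rfl
  have e7 : BExpr.Holds σ (.eq Var.n 7) ↔ n = 7 := by rw [← hσn]; exact Iff.rfl
  have e8 : BExpr.Holds σ (.eq Var.n 8) ↔ n = 8 := by rw [← hσn]; exact Iff.rfl
  simp only [Cmd.run, e3, e6, e7, e8, boundPosSincere, boundPosSincereProg]
  split_ifs <;> simp [NExpr.eval, hσn]

/-- The factor 113 = 112 + 1 covers the exceptional value at n = 8 using only `1 ≤ n ^ 2`; likewise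
22 = 21 + 1 in the linear bound below. -/
theorem boundPos_le (hn : 1 ≤ n) : boundPos n + 1 ≤ 113 * n ^ 2 := by
  have h2 : 1 ≤ n ^ 2 := Nat.one_le_pow _ _ hn
  unfold boundPos
  split_ifs
  · have : (n ^ 2 - n) / 2 ≤ n ^ 2 := (Nat.div_le_self _ _).trans (Nat.sub_le _ _)
    omega
  all_goals omega

theorem boundPosSincere_le (hn : 1 ≤ n) : boundPosSincere n + 1 ≤ 22 * n := by
  unfold boundPosSincere
  split_ifs <;> omega

end Machine

theorem theorem3 :
    (∃ C : ℕ, ∀ (n : ℕ) [NeZero n] (A : Matrix (Fin n) (Fin n) ℝ),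
      IsUnidiagonal A → IsTriangleIntegral A → (Bigraph.ofMatrix A).Connected →
      ∀ (s : Fin 4) (ω : ℕ → ℕ), ∃ (τ : Machine.State) (t : ℕ) (D : Bigraph n),
        Machine.Exec Machine.posDefTestByInflationsProg (Machine.initial A s ω) τ t ∧
        t ≤ C * n ^ 4 ∧
        Machine.Stores τ D ∧
        PosDefTestByInflations A s D (τ.reg .result == 1)) ∧
    (∃ C : ℕ, ∀ (n : ℕ) [NeZero n] (A : Matrix (Fin n) (Fin n) ℝ),
      IsUnidiagonal A → IsTriangleIntegral A → (Bigraph.ofMatrix A).Connected →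
      ∀ (s : Fin 4) (ω : ℕ → ℕ), ∃ (τ : Machine.State) (t : ℕ) (D : Bigraph n),
        Machine.Exec Machine.posDefTestByRootInflationsProg (Machine.initial A s ω) τ t ∧
        t ≤ C * n ^ 3 ∧
        Machine.Stores τ D ∧
        PosDefTestByRootInflations A s D (τ.reg .result == 1)) := by
  constructor
  -- One summand per stage: Gram matrix, limit, inflations, recognition. The third is the quadratic
  -- number of passes times the quadratic cost of a pass.
  · refine ⟨60 + 60 + 113 * 300 + 1100, fun n _ A hA hA' _ s ω => ?_⟩
    have hn : 1 ≤ n := NeZero.one_le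
    have key : Machine.Runs Machine.posDefTestByInflationsProg (Machine.initial A s ω)
        (60 * n ^ 2 + (60 + ((boundPos n + 1) * (300 * n ^ 2) + 1100 * n ^ 3))) fun τ =>
        ∃ D : Bigraph n, Machine.Stores τ D ∧
          PosDefTestByInflations A s D (τ.reg .result == 1) := by
      refine (Machine.runs_gramProg hn rfl hA hA' fun i j => by simp [Machine.initial]).seq ?_
      intro τ₁ hf₁ h₁
      have hn₁ : τ₁.reg .n = n := hf₁.reg _ rfl
      refine (Machine.runs_boundPosProg hn₁).seq ?_
      intro τ₂ hf₂ h₂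
      have hn₂ : τ₂.reg .n = n := (hf₂.reg _ rfl).trans hn₁
      have hs₂ : τ₂.reg .strategy = s := (hf₂.reg _ rfl).trans (hf₁.reg _ rfl)
      rw [← h₂]
      refine (Machine.runs_inflationsAtPairProg hn hn₂ (h₁.congr (hf₂.mat rfl)) hs₂).seq ?_
      rintro τ₃ hf₃ ⟨D, hD, hrun⟩
      have hn₃ : τ₃.reg .n = n := (hf₃.reg _ rfl).trans hn₂
      refine (Machine.runs_dynkinProg hn hn₃ hD).imp fun τ₄ hf₄ h₄ => ?_
      exact ⟨D, hD.congr (hf₄.mat rfl), by rwa [h₂] at hrun, by simpa using h₄⟩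
    obtain ⟨τ, t, hexec, ht, D, hD, hres⟩ := key
    refine ⟨τ, t, D, hexec, ht.trans ?_, hD, hres⟩
    have h1 : 1 ≤ n ^ 4 := Nat.one_le_pow _ _ hn
    have h2 : n ^ 2 ≤ n ^ 4 := Nat.pow_le_pow_right hn (by omega)
    have h3 : n ^ 3 ≤ n ^ 4 := Nat.pow_le_pow_right hn (by omega)
    have h4 : (boundPos n + 1) * (300 * n ^ 2) ≤ 113 * 300 * n ^ 4 :=
      (Nat.mul_le_mul_right _ (Machine.boundPos_le hn)).trans_eq (by ring)
    omega
  -- The summand 500 belongs to the root procedure; the number of passes of the inflation loop is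
  -- now linear.
  · refine ⟨60 + 500 + 60 + 22 * 300 + 1100, fun n _ A hA hA' hc s ω => ?_⟩
    have hn : 1 ≤ n := NeZero.one_le
    have key : Machine.Runs Machine.posDefTestByRootInflationsProg (Machine.initial A s ω)
        (60 * n ^ 2 + (500 * n ^ 3 + (60 + ((boundPosSincere n + 1) * (300 * n ^ 2) +
          1100 * n ^ 3)))) fun τ => ∃ D : Bigraph n, Machine.Stores τ D ∧
          PosDefTestByRootInflations A s D (τ.reg .result == 1) := by
      refine (Machine.runs_gramProg hn rfl hA hA' fun i j => by simp [Machine.initial]).seq ?_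
      intro τ₁ hf₁ h₁
      have hn₁ : τ₁.reg .n = n := hf₁.reg _ rfl
      refine (Machine.runs_rootProg hn₁ h₁ hc).seq ?_
      rintro τ₂ hf₂ ⟨D', hD', hroot⟩
      have hn₂ : τ₂.reg .n = n := (hf₂.reg _ rfl).trans hn₁
      refine (Machine.runs_boundPosSincereProg hn₂).seq ?_
      intro τ₃ hf₃ h₃
      have hn₃ : τ₃.reg .n = n := (hf₃.reg _ rfl).trans hn₂
      have hs₃ : τ₃.reg .strategy = s :=
        ((hf₃.reg _ rfl).trans (hf₂.reg _ rfl)).trans (hf₁.reg _ rfl)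
      rw [← h₃]
      refine (Machine.runs_inflationsAtPairProg hn hn₃ (hD'.congr (hf₃.mat rfl)) hs₃).seq ?_
      rintro τ₄ hf₄ ⟨D, hD, hrun⟩
      have hn₄ : τ₄.reg .n = n := (hf₄.reg _ rfl).trans hn₃
      refine (Machine.runs_dynkinProg hn hn₄ hD).imp fun τ₅ hf₅ h₅ => ?_
      exact ⟨D, hD.congr (hf₅.mat rfl), ⟨D', hroot, by rwa [h₃] at hrun⟩, by simpa using h₅⟩
    obtain ⟨τ, t, hexec, ht, D, hD, hres⟩ := key
    refine ⟨τ, t, D, hexec, ht.trans ?_, hD, hres⟩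
    have h1 : 1 ≤ n ^ 3 := Nat.one_le_pow _ _ hn
    have h2 : n ^ 2 ≤ n ^ 3 := Nat.pow_le_pow_right hn (by omega)
    have h4 : (boundPosSincere n + 1) * (300 * n ^ 2) ≤ 22 * 300 * n ^ 3 :=
      (Nat.mul_le_mul_right _ (Machine.boundPosSincere_le hn)).trans_eq (by ring)
    omega
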